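/- Let $k\ge 2$ and $s\ge 4$ be integers. For a tuple $\mathbf a=(a_1,\dots,a_s)$ of nonzero integers put $|\mathbf a|=\max_j|a_j|$ and consider the equation $$a_1x_1^k+\dots+a_sx_s^k=0.\qquad(1)$$ For a prime $p$ let $\mathcal C_p(k,s)$ be the set of tuples $\mathbf a$ of nonzero integers such that (1) has a solution with all $x_j\in\mathbb Z_p^\times$, and let $\mathcal C'(k,s)$ be the set of tuples $\mathbf a$ of nonzero integers such that (1) has a solution with all $x_j$ positive reals and, for every prime $p$, a solution with all $x_j\in\mathbb Z_p^\times$. Put $$\delta_\infty=1-2^{1-s},\qquad \delta_p=\lim_{A\to\infty}\frac{\#\{\mathbf a\in\mathcal C_p(k,s):|\mathbf a|\le A\}}{(2A)^s},\qquad \mathfrak D_{s,k}=\delta_\infty\prod_p\delta_p .$$ Then: 1. $\delta_\infty>0$, and $\delta_\infty$ is the density of the $\mathbf a$ for which (1) is soluble in positive reals, i.e. the number of such $\mathbf a$ with $|\mathbf a|\le A$, divided by $(2A)^s$, tends to $\delta_\infty$ as $A\to\infty$. 2. For every prime $p$ the limit defining $\delta_p$ exists and is positive. 3. The product $\prod_p\delta_p$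 converges unconditionally, and $\mathfrak D_{s,k}>0$. 4. As $A\to\infty$ through the reals, $$\#\{\mathbf a\in\mathcal C'(k,s):|\mathbf a|\le A\}=\mathfrak D_{s,k}(2A)^s+O\!\left(\frac{A^s}{(\log A)^{s-3}}\right),$$ where the implied constant depends only on $s$ and $k$. 5. For all primes $p$ sufficiently large in terms of $s$ and $k$, $$\delta_p=1-\left(1-\frac1{p^s}\right)^{-1}\left(s\left(1-\frac1p\right)\frac1{p^{s-1}}+\frac{s(s-1)}2\left(1-\frac1p\right)^2\left(1-\frac1{g_{p,k}}\right)\frac1{p^{s-2}}\right),$$ where $g_{p,k}=\gcd(p-1,k)$. -/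

import Mathlib

open Filter Topology Asymptotics

noncomputable section

namespace DiagonalDensity

instance primesFact (p : Nat.Primes) : Fact (Nat.Prime (p : ℕ)) := ⟨p.2⟩

/-- The tuples of nonzero integers `a` for which `a₁x₁ᵏ + ⋯ + aₛxₛᵏ = 0` has a solution in
positive real numbers. -/
def realSoluble (k s : ℕ) : Set (Fin s → ℤ) :=
  {a | (∀ j, a j ≠ 0) ∧ ∃ x : Fin s → ℝ, (∀ j, 0 < x j) ∧ ∑ j, (a j : ℝ) * x j ^ k = 0}

/-- The tuples of nonzero integers `a` for which `a₁x₁ᵏ + ⋯ + aₛxₛᵏ = 0` has a solution in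
units of the `p`-adic integers. -/
def padicSoluble (k s : ℕ) (p : Nat.Primes) : Set (Fin s → ℤ) :=
  {a | (∀ j, a j ≠ 0) ∧
    ∃ x : Fin s → (ℤ_[(p : ℕ)])ˣ, ∑ j, (a j : ℤ_[(p : ℕ)]) * (x j : ℤ_[(p : ℕ)]) ^ k = 0}

/-- The tuples of nonzero integers `a` for which `a₁x₁ᵏ + ⋯ + aₛxₛᵏ = 0` is soluble in positive
reals and, for every prime `p`, in `p`-adic units. -/
def everywhereSoluble (k s : ℕ) : Set (Fin s → ℤ) :=
  {a | a ∈ realSoluble k s ∧ ∀ p : Nat.Primes, a ∈ padicSoluble k s p}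

/-- The number of `a ∈ S` with `max |aⱼ| ≤ A`. -/
def boxCount {s : ℕ} (S : Set (Fin s → ℤ)) (A : ℝ) : ℕ :=
  Set.ncard {a : Fin s → ℤ | a ∈ S ∧ ∀ j, |(a j : ℝ)| ≤ A}

/-- The proportion of the box `|a| ≤ A` that lies in `S`. -/
def boxProportion {s : ℕ} (S : Set (Fin s → ℤ)) (A : ℝ) : ℝ :=
  (boxCount S A : ℝ) / (2 * A) ^ s

/-- `S` has density `d`. -/
def HasDensity {s : ℕ} (S : Set (Fin s → ℤ)) (d : ℝ) : Prop :=
  Tendsto (boxProportion S) atTop (𝓝 d)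

/-- The real density `δ_∞ = 1 - 2 ^ (1 - s)`. -/
def deltaInfty (s : ℕ) : ℝ := 1 - (2 : ℝ) ^ (1 - (s : ℤ))

/-- The local density `δ_p`, the limit of the proportion of `|a| ≤ A` soluble in `p`-adic units.
The theorem asserts separately that the limit exists. -/
def delta (k s : ℕ) (p : Nat.Primes) : ℝ :=
  limUnder atTop (boxProportion (padicSoluble k s p))

/-- `δ_∞ ∏_p δ_p`. The theorem asserts separately that the product converges. -/
def totalDensity (s k : ℕ) : ℝ := deltaInfty s * ∏' p : Nat.Primes, delta k s p

end DiagonalDensity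

end

/-! Real solubility only says that both signs occur among the coefficients. At a prime `p`, Hensel's
lemma shows that solubility of a tuple not divisible by `p ^ n` depends only on its residues modulo
a power of `p` (`isPeriodic_levelSet`); tuples divisible by `p ^ n` have proportion at most `p ^ (-n
s)`. Periodic sets are counted in boxes by `abs_boxCount_sub_le`, and letting `n` grow gives the
density at `p`. Splitting off the tuples divisible by `p` gives `delta_mul_eq`, the source of the
factor `(1 - p ^ (-s))⁻¹`.

For `p > 16 k ^ 6`, an exponential sum argument shows that three coefficients prime to `p` suffice
for solubility (`exists_unit_zero_of_three`). An insoluble tuple then has all but two coefficients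
divisible by `p`, so `1 - δ_p` is `O(p ^ (2 - s))`; as `s ≥ 4`, the product converges. Counting the
insoluble residue tuples with at most two nonzero entries gives the exact value of `δ_p`.

For the asymptotic formula, local conditions are imposed only at primes up to `P`, truncated at a
power of `p` that is at least `P`. By the Chinese remainder theorem the resulting `sieveSet` is
periodic with modulus `Q = lcm(1, …, P) ^ (2k + 4)`, which Chebyshev bounds by `exp (O(P))`. Lattice
point counting costs a relative error `O(Q / A)`; truncation and the primes beyond `P` cost `O(P ^
(3 - s))`. Taking `P` to be a small multiple of `log A` makes `Q ≤ A ^ (1/2)`. -/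

noncomputable section

namespace DiagonalDensity

/-! ### Counting points of periodic sets in boxes -/

/-- `T` is a union of residue classes modulo `Q`. -/
def IsPeriodic {s : ℕ} (Q : ℕ) (T : Set (Fin s → ℤ)) : Prop :=
  ∀ a b : Fin s → ℤ, (∀ j, (a j : ZMod Q) = b j) → a ∈ T → b ∈ T

/-- The residues modulo `Q` of the elements of `T`. -/
def residues {s : ℕ} (Q : ℕ) (T : Set (Fin s → ℤ)) : Set (Fin s → ZMod Q) :=
  (fun a j => (a j : ZMod Q)) '' T

/-- The proportion of residues modulo `Q` occupied by `T`. -/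
def periodDensity {s : ℕ} (Q : ℕ) (T : Set (Fin s → ℤ)) : ℝ :=
  ((residues Q T).ncard : ℝ) / (Q : ℝ) ^ s

/-- Tuples of nonzero integers whose sign pattern lies in `E`. -/
def signed {s : ℕ} (E : Finset (Fin s → Bool)) : Set (Fin s → ℤ) :=
  {a | (∀ j, a j ≠ 0) ∧ (fun j => decide (0 < a j)) ∈ E}

/-- The box of radius `A`. -/
def box (s : ℕ) (A : ℝ) : Set (Fin s → ℤ) := {a | ∀ j, |(a j : ℝ)| ≤ A}

theorem mem_residues_iff {s Q : ℕ} {T : Set (Fin s → ℤ)} (hT : IsPeriodic Q T) (a : Fin s → ℤ) :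
    (fun j => (a j : ZMod Q)) ∈ residues Q T ↔ a ∈ T := by
  constructor
  · rintro ⟨b, hb, h⟩
    exact hT b a (fun j => congrFun h j) hb
  · exact fun h => ⟨a, h, rfl⟩

theorem finite_int_abs_le (A : ℝ) : {n : ℤ | |(n : ℝ)| ≤ A}.Finite := by
  refine (Set.finite_Icc (-⌊A⌋) ⌊A⌋).subset fun n hn => ?_
  have h := abs_le.1 (show |(n : ℝ)| ≤ A from hn)
  refine ⟨?_, Int.le_floor.2 h.2⟩
  have : -n ≤ ⌊A⌋ := Int.le_floor.2 (by push_cast; linarith)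
  omega

theorem finite_box (s : ℕ) (A : ℝ) : (box s A).Finite := by
  have : box s A = Set.pi Set.univ fun _ => {n : ℤ | |(n : ℝ)| ≤ A} := by
    ext a; simp [box]
  rw [this]
  exact Set.Finite.pi' (fun _ => finite_int_abs_le A) |>.subset (fun a ha j => ha j trivial)

theorem boxCount_eq {s : ℕ} (S : Set (Fin s → ℤ)) (A : ℝ) :
    boxCount S A = (S ∩ box s A).ncard := rfl

theorem finite_inter_box {s : ℕ} (S : Set (Fin s → ℤ)) (A : ℝ) : (S ∩ box s A).Finite :=
  (finite_box s A).subset Set.inter_subset_right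

theorem boxCount_mono {s : ℕ} {S T : Set (Fin s → ℤ)} (h : S ⊆ T) (A : ℝ) :
    boxCount S A ≤ boxCount T A := by
  rw [boxCount_eq, boxCount_eq]
  exact Set.ncard_le_ncard (Set.inter_subset_inter_left _ h) (finite_inter_box _ _)

theorem boxCount_union_le {s : ℕ} (S T : Set (Fin s → ℤ)) (A : ℝ) :
    boxCount (S ∪ T) A ≤ boxCount S A + boxCount T A := by
  simp only [boxCount_eq, Set.union_inter_distrib_right]
  exact Set.ncard_union_le _ _

theorem boxCount_biUnion_le {s : ℕ} {ι : Type*} (I : Finset ι) (S : ι → Set (Fin s → ℤ)) (A : ℝ) :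
    boxCount (⋃ i ∈ I, S i) A ≤ ∑ i ∈ I, boxCount (S i) A := by
  classical
  induction I using Finset.induction_on with
  | empty => simp [boxCount_eq]
  | insert i I hi ih =>
    rw [Finset.set_biUnion_insert, Finset.sum_insert hi]
    exact (boxCount_union_le _ _ _).trans (Nat.add_le_add_left ih _)

/-- The integers of a given sign in a residue class with absolute value at most `A`. -/
def signedClass (Q : ℕ) (A : ℝ) (b : Bool) (r : ZMod Q) : Set ℤ :=
  {n | n ≠ 0 ∧ |(n : ℝ)| ≤ A ∧ decide (0 < n) = b ∧ (n : ZMod Q) = r}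

/-- The integers of one sign form a half-open interval of length `⌊A⌋`, so the count is a difference
of two floors, within 1 of `⌊A⌋ / Q`; replacing `⌊A⌋` by `A` costs at most another 1. -/
theorem abs_ncard_signedClass_sub_le {Q : ℕ} (hQ : 0 < Q) {A : ℝ} (hA : 0 ≤ A) (b : Bool)
    (r : ZMod Q) : |((signedClass Q A b r).ncard : ℝ) - A / Q| ≤ 2 := by
  have : NeZero Q := ⟨hQ.ne'⟩
  obtain ⟨v, rfl⟩ := ZMod.intCast_surjective r
  have hQ' : (0 : ℤ) < Q := by exact_mod_cast hQ
  have hfl : 0 ≤ ⌊A⌋ := Int.floor_nonneg.2 hA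
  have hA1 := Int.floor_le A
  have hA2 := Int.lt_floor_add_one A
  have hQ1 : (1 : ℝ) ≤ Q := by exact_mod_cast hQ
  have hQ0 : (0 : ℝ) < Q := by linarith
  have hdiff : A / Q - 1 ≤ (⌊A⌋ : ℝ) / Q ∧ (⌊A⌋ : ℝ) / Q ≤ A / Q := by
    refine ⟨?_, by gcongr⟩
    rw [sub_le_iff_le_add, div_add_one hQ0.ne', div_le_div_iff_of_pos_right hQ0]
    linarith
  have key : ∀ (x y : ℤ), x ≤ y → |((max (⌊((y : ℤ) : ℚ)/(Q:ℤ)⌋ - ⌊((x : ℤ) : ℚ)/(Q:ℤ)⌋) 0 : ℤ) : ℝ)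
      - ((y - x : ℤ) : ℝ) / Q| ≤ 1 := by
    intro x y hxy
    have h1 := Int.floor_le ((y : ℚ)/(Q:ℤ))
    have h2 := Int.lt_floor_add_one ((y : ℚ)/(Q:ℤ))
    have h3 := Int.floor_le ((x : ℚ)/(Q:ℤ))
    have h4 := Int.lt_floor_add_one ((x : ℚ)/(Q:ℤ))
    have hmono : ⌊((x : ℤ) : ℚ)/(Q:ℤ)⌋ ≤ ⌊((y : ℤ) : ℚ)/(Q:ℤ)⌋ := by
      apply Int.floor_mono
      have : (0 : ℚ) < (Q : ℤ) := by exact_mod_cast hQ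
      gcongr
    rw [max_eq_left (by omega)]
    have : |((⌊((y : ℤ) : ℚ)/(Q:ℤ)⌋ - ⌊((x : ℤ) : ℚ)/(Q:ℤ)⌋ : ℤ) : ℚ)
      - ((y - x : ℤ) : ℚ) / Q| ≤ 1 := by
      push_cast [sub_div] at *
      rw [abs_le]
      constructor <;> linarith
    exact_mod_cast this
  cases b with
  | true =>
    have hset : signedClass Q A true (v : ZMod Q) =
        ((Finset.Ioc 0 ⌊A⌋).filter (fun x => x ≡ v [ZMOD Q]) : Finset ℤ) := by
      ext n
      simp only [signedClass, Set.mem_ofPred_eq, decide_eq_true_eq, Finset.coe_filter,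
        Finset.mem_Ioc, ZMod.intCast_eq_intCast_iff]
      constructor
      · rintro ⟨_, h2, h3, h4⟩
        exact ⟨⟨h3, Int.le_floor.2 (le_of_abs_le h2)⟩, h4⟩
      · rintro ⟨⟨h1, h2⟩, h3⟩
        refine ⟨h1.ne', ?_, h1, h3⟩
        have : (0 : ℝ) < n := by exact_mod_cast h1
        rw [abs_of_pos this]
        exact Int.le_floor.1 h2
    rw [hset, Set.ncard_coe_finset]
    have hc := Int.Ioc_filter_modEq_card 0 ⌊A⌋ hQ' v
    have hk := key (0 - v) (⌊A⌋ - v) (by omega)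
    have hc' : (((Finset.Ioc 0 ⌊A⌋).filter (fun x => x ≡ v [ZMOD Q])).card : ℝ) =
      ((max (⌊((⌊A⌋ - v : ℤ) : ℚ)/(Q:ℤ)⌋ - ⌊((0 - v : ℤ) : ℚ)/(Q:ℤ)⌋) 0 : ℤ) : ℝ) := by
      have := congrArg (fun x : ℤ => (x : ℝ)) hc
      push_cast at this ⊢
      exact this
    rw [hc']
    rw [abs_le] at hk ⊢
    have e : ((⌊A⌋ - v - (0 - v) : ℤ) : ℝ) = ⌊A⌋ := by push_cast; ring
    rw [e] at hk
    constructor <;> linarith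
  | false =>
    -- The interval is open on the left, hence the endpoint `-⌊A⌋ - 1`; the right endpoint `-1`
    -- leaves out zero.
    have hset : signedClass Q A false (v : ZMod Q) =
        ((Finset.Ioc (-⌊A⌋ - 1) (-1)).filter (fun x => x ≡ v [ZMOD Q]) : Finset ℤ) := by
      ext n
      simp only [signedClass, Set.mem_ofPred_eq, decide_eq_false_iff_not, Finset.coe_filter,
        Finset.mem_Ioc, ZMod.intCast_eq_intCast_iff]
      constructor
      · rintro ⟨h1, h2, h3, h4⟩
        refine ⟨⟨?_, by omega⟩, h4⟩
        have : -n ≤ ⌊A⌋ := Int.le_floor.2 (by push_cast; exact neg_le_of_abs_le h2 |> fun h => by linarith)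
        omega
      · rintro ⟨⟨h1, h2⟩, h3⟩
        refine ⟨by omega, ?_, by omega, h3⟩
        have hn : (n : ℝ) ≤ 0 := by exact_mod_cast (by omega : n ≤ 0)
        rw [abs_of_nonpos hn]
        have : -n ≤ ⌊A⌋ := by omega
        have := Int.le_floor.1 this
        push_cast at this
        exact this
    rw [hset, Set.ncard_coe_finset]
    have hc := Int.Ioc_filter_modEq_card (-⌊A⌋ - 1) (-1) hQ' v
    have hk := key (-⌊A⌋ - 1 - v) (-1 - v) (by omega)
    have hc' : (((Finset.Ioc (-⌊A⌋ - 1) (-1)).filter (fun x => x ≡ v [ZMOD Q])).card : ℝ) =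
      ((max (⌊((-1 - v : ℤ) : ℚ)/(Q:ℤ)⌋ - ⌊((-⌊A⌋ - 1 - v : ℤ) : ℚ)/(Q:ℤ)⌋) 0 : ℤ) : ℝ) := by
      have := congrArg (fun x : ℤ => (x : ℝ)) hc
      push_cast at this ⊢
      exact this
    rw [hc']
    rw [abs_le] at hk ⊢
    have e : ((-1 - v - (-⌊A⌋ - 1 - v) : ℤ) : ℝ) = ⌊A⌋ := by push_cast; ring
    rw [e] at hk
    constructor <;> linarith

/-- Factors are replaced by `X` one at a time, each being at most `3 * X` in absolute value.
Carrying the extra factor `X` on the left avoids the exponent `J.card - 1` and lets the induction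
start at the empty set. -/
theorem mul_abs_prod_sub_pow_le {ι : Type*} (J : Finset ι) (c : ι → ℝ) {X : ℝ} (hX : 1 ≤ X)
    (hc : ∀ j, |c j - X| ≤ 2) : X * |∏ j ∈ J, c j - X ^ J.card| ≤ (3 * X) ^ J.card := by
  classical
  have hc' : ∀ j, |c j| ≤ 3 * X := fun j => by
    have := abs_le.1 (hc j)
    rw [abs_le]; constructor <;> linarith
  induction J using Finset.induction_on with
  | empty => simp
  | insert i J hi ih =>
    rw [Finset.prod_insert hi, Finset.card_insert_of_notMem hi]
    have h1 : |∏ j ∈ J, c j| ≤ (3 * X) ^ J.card := by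
      rw [Finset.abs_prod]
      rw [← Finset.prod_const]
      exact Finset.prod_le_prod (fun _ _ => abs_nonneg _) fun j _ => hc' j
    have h2 : c i * ∏ j ∈ J, c j - X ^ (J.card + 1) =
        (c i - X) * ∏ j ∈ J, c j + X * (∏ j ∈ J, c j - X ^ J.card) := by ring
    rw [h2]
    calc X * |(c i - X) * ∏ j ∈ J, c j + X * (∏ j ∈ J, c j - X ^ J.card)|
        ≤ X * (|(c i - X) * ∏ j ∈ J, c j| + |X * (∏ j ∈ J, c j - X ^ J.card)|) := by
          gcongr; exact abs_add_le _ _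
      _ = X * (|c i - X| * |∏ j ∈ J, c j|) + X * (X * |∏ j ∈ J, c j - X ^ J.card|) := by
          rw [abs_mul, abs_mul, abs_of_pos (by linarith : 0 < X)]; ring
      _ ≤ X * (2 * (3 * X) ^ J.card) + X * (3 * X) ^ J.card := by
          gcongr
          exact hc i
      _ = (3 * X) ^ (J.card + 1) := by ring

/-- Fixing the sign pattern and the residue vector makes the set a product of one-dimensional
classes, each with about `A / Q` elements. Summing over the occupied residues keeps the density as a
factor of the error, which is therefore of relative size `Q / A`. -/
theorem abs_boxCount_sub_le {s Q : ℕ} (hQ : 0 < Q) {T : Set (Fin s → ℤ)} (hT : IsPeriodic Q T)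
    (E : Finset (Fin s → Bool)) {A : ℝ} (hA : (Q : ℝ) ≤ A) :
    |(boxCount (T ∩ signed E) A : ℝ) - E.card * periodDensity Q T * A ^ s| ≤
      E.card * periodDensity Q T * 3 ^ s * A ^ s * (Q / A) := by
  classical
  have : NeZero Q := ⟨hQ.ne'⟩
  have hQ0 : (0 : ℝ) < Q := by exact_mod_cast hQ
  have hA0 : 0 < A := by linarith
  set F : Finset (Fin s → ℤ) := (finite_inter_box (T ∩ signed E) A).toFinset with hF
  set R : Finset (Fin s → ZMod Q) := (Set.toFinite (residues Q T)).toFinset with hR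
  have hcard : boxCount (T ∩ signed E) A = F.card := by
    rw [boxCount_eq, Set.ncard_eq_toFinset_card _ (finite_inter_box _ _)]
  have hRcard : (residues Q T).ncard = R.card := Set.ncard_eq_toFinset_card _ _
  let f : (Fin s → ℤ) → (Fin s → Bool) × (Fin s → ZMod Q) :=
    fun a => (fun j => decide (0 < a j), fun j => (a j : ZMod Q))
  have hmaps : ∀ a ∈ F, f a ∈ E ×ˢ R := by
    intro a ha
    rw [hF, Set.Finite.mem_toFinset] at ha
    rw [Finset.mem_product]
    refine ⟨ha.1.2.2, ?_⟩
    rw [hR, Set.Finite.mem_toFinset]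
    exact ⟨a, ha.1.1, rfl⟩
  have hfib : ∀ e ∈ E ×ˢ R, ((F.filter fun a => f a = e).card : ℝ) =
      ∏ j, ((signedClass Q A (e.1 j) (e.2 j)).ncard : ℝ) := by
    rintro ⟨ε, r⟩ he
    rw [Finset.mem_product] at he
    have hfin : ∀ j, (signedClass Q A (ε j) (r j)).Finite := fun j =>
      (finite_int_abs_le A).subset fun n hn => hn.2.1
    have : F.filter (fun a => f a = (ε, r)) =
        Fintype.piFinset fun j => (hfin j).toFinset := by
      ext a
      simp only [Finset.mem_filter, Fintype.mem_piFinset, Set.Finite.mem_toFinset, hF]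
      constructor
      · rintro ⟨ha, hfa⟩ j
        have h1 := congrFun (congrArg Prod.fst hfa) j
        have h2 := congrFun (congrArg Prod.snd hfa) j
        exact ⟨ha.1.2.1 j, ha.2 j, h1, h2⟩
      · intro ha
        have hfa : f a = (ε, r) := Prod.ext (funext fun j => (ha j).2.2.1)
          (funext fun j => (ha j).2.2.2)
        refine ⟨⟨⟨?_, fun j => (ha j).1, ?_⟩, fun j => (ha j).2.1⟩, hfa⟩
        · rw [← mem_residues_iff hT]
          have h2 : (fun j => (a j : ZMod Q)) = r := congrArg Prod.snd hfa
          rw [h2]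
          simpa [hR] using he.2
        · have h1 : (fun j => decide (0 < a j)) = ε := congrArg Prod.fst hfa
          rw [h1]; exact he.1
    rw [this, Fintype.card_piFinset]
    push_cast
    exact Finset.prod_congr rfl fun j _ => by rw [Set.ncard_eq_toFinset_card _ (hfin j)]
  have hX : 1 ≤ A / Q := (one_le_div hQ0).2 hA
  have hXp : 0 < A / Q := by linarith
  have hsum : (boxCount (T ∩ signed E) A : ℝ) - E.card * periodDensity Q T * A ^ s =
      ∑ e ∈ E ×ˢ R, (∏ j, ((signedClass Q A (e.1 j) (e.2 j)).ncard : ℝ) - (A / Q) ^ s) := by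
    rw [Finset.sum_sub_distrib, Finset.sum_const, Finset.card_product, hcard,
      Finset.card_eq_sum_card_fiberwise hmaps]
    push_cast
    rw [Finset.sum_congr rfl hfib, periodDensity, hRcard, nsmul_eq_mul]
    push_cast
    rw [div_pow]
    ring
  rw [hsum]
  have hterm : ∀ e ∈ E ×ˢ R,
      |∏ j, ((signedClass Q A (e.1 j) (e.2 j)).ncard : ℝ) - (A / Q) ^ s| ≤
        (3 * (A / Q)) ^ s / (A / Q) := by
    intro e _
    have := mul_abs_prod_sub_pow_le Finset.univ
      (fun j => ((signedClass Q A (e.1 j) (e.2 j)).ncard : ℝ)) hX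
      (fun j => abs_ncard_signedClass_sub_le hQ hA0.le _ _)
    rw [Finset.card_univ, Fintype.card_fin] at this
    rw [le_div_iff₀' hXp]
    exact this
  refine (Finset.abs_sum_le_sum_abs _ _).trans ((Finset.sum_le_sum hterm).trans ?_)
  rw [Finset.sum_const, Finset.card_product, periodDensity, hRcard, nsmul_eq_mul]
  push_cast
  rw [mul_pow, div_pow]
  apply le_of_eq
  field_simp

theorem periodDensity_nonneg {s : ℕ} (Q : ℕ) (T : Set (Fin s → ℤ)) : 0 ≤ periodDensity Q T := by
  unfold periodDensity; positivity

theorem periodDensity_le_one {s Q : ℕ} (hQ : 0 < Q) (T : Set (Fin s → ℤ)) :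
    periodDensity Q T ≤ 1 := by
  have : NeZero Q := ⟨hQ.ne'⟩
  unfold periodDensity
  have hQ0 : (0 : ℝ) < Q := by exact_mod_cast hQ
  rw [div_le_one (by positivity)]
  have h : (residues Q T).ncard ≤ Nat.card (Fin s → ZMod Q) := Set.ncard_le_card _
  rw [Nat.card_eq_fintype_card, Fintype.card_fun, ZMod.card, Fintype.card_fin] at h
  exact_mod_cast h

theorem periodDensity_pos {s Q : ℕ} (hQ : 0 < Q) {T : Set (Fin s → ℤ)} (hT : T.Nonempty) :
    0 < periodDensity Q T := by
  have : NeZero Q := ⟨hQ.ne'⟩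
  unfold periodDensity
  have hQ0 : (0 : ℝ) < Q := by exact_mod_cast hQ
  have h : 0 < (residues Q T).ncard := (Set.ncard_pos (Set.toFinite _)).2 (hT.image _)
  positivity

theorem periodDensity_one_univ (s : ℕ) : periodDensity 1 (Set.univ : Set (Fin s → ℤ)) = 1 := by
  have : residues 1 (Set.univ : Set (Fin s → ℤ)) = Set.univ :=
    Set.eq_univ_of_forall fun r => ⟨0, trivial, Subsingleton.elim _ _⟩
  simp [periodDensity, this, Set.ncard_univ]

theorem periodDensity_inter {s Q₁ Q₂ : ℕ} (h : Q₁.Coprime Q₂) {T₁ T₂ : Set (Fin s → ℤ)}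
    (h₁ : IsPeriodic Q₁ T₁) (h₂ : IsPeriodic Q₂ T₂) :
    periodDensity (Q₁ * Q₂) (T₁ ∩ T₂) = periodDensity Q₁ T₁ * periodDensity Q₂ T₂ := by
  let e := ZMod.chineseRemainder h
  let f : (Fin s → ZMod (Q₁ * Q₂)) → (Fin s → ZMod Q₁) × (Fin s → ZMod Q₂) :=
    fun r => (fun j => (e (r j)).1, fun j => (e (r j)).2)
  have hf : Function.Injective f := by
    intro r r' hr
    funext j
    apply e.injective
    exact Prod.ext (congrFun (congrArg Prod.fst hr) j) (congrFun (congrArg Prod.snd hr) j)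
  have he : ∀ n : ℤ, e (n : ZMod (Q₁ * Q₂)) = ((n : ZMod Q₁), (n : ZMod Q₂)) := fun n => by
    rw [map_intCast]; rfl
  have himg : f '' residues (Q₁ * Q₂) (T₁ ∩ T₂) = residues Q₁ T₁ ×ˢ residues Q₂ T₂ := by
    ext ⟨r₁, r₂⟩
    constructor
    · rintro ⟨_, ⟨a, ha, rfl⟩, h⟩
      rw [← h]
      refine ⟨⟨a, ha.1, ?_⟩, ⟨a, ha.2, ?_⟩⟩ <;> funext j <;> simp [f, he]
    · rintro ⟨h1, h2⟩
      choose a ha using fun j => ZMod.intCast_surjective (e.symm (r₁ j, r₂ j))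
      have ha' : ∀ j, ((a j : ZMod Q₁), (a j : ZMod Q₂)) = (r₁ j, r₂ j) := fun j => by
        rw [← he, ha, RingEquiv.apply_symm_apply]
      have e1 : (fun j => (a j : ZMod Q₁)) = r₁ := funext fun j => congrArg Prod.fst (ha' j)
      have e2 : (fun j => (a j : ZMod Q₂)) = r₂ := funext fun j => congrArg Prod.snd (ha' j)
      have m1 : a ∈ T₁ := by rw [← mem_residues_iff h₁, e1]; exact h1
      have m2 : a ∈ T₂ := by rw [← mem_residues_iff h₂, e2]; exact h2
      refine ⟨_, ⟨a, ⟨m1, m2⟩, rfl⟩, ?_⟩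
      refine Prod.ext ?_ ?_
      · rw [← e1]; funext j; simp [f, he]
      · rw [← e2]; funext j; simp [f, he]
  have hcard := congrArg Set.ncard himg
  rw [Set.ncard_image_of_injective _ hf, Set.ncard_prod] at hcard
  unfold periodDensity
  rw [hcard]
  push_cast
  rw [mul_pow, mul_div_mul_comm]

theorem IsPeriodic.of_dvd {s Q Q' : ℕ} (h : Q ∣ Q') {T : Set (Fin s → ℤ)} (hT : IsPeriodic Q T) :
    IsPeriodic Q' T := by
  intro a b hab
  refine hT a b fun j => ?_
  have := hab j
  rw [ZMod.intCast_eq_intCast_iff] at this ⊢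
  exact this.of_dvd (by exact_mod_cast h)

theorem IsPeriodic.inter {s Q : ℕ} {T T' : Set (Fin s → ℤ)} (hT : IsPeriodic Q T)
    (hT' : IsPeriodic Q T') : IsPeriodic Q (T ∩ T') :=
  fun a b h ha => ⟨hT a b h ha.1, hT' a b h ha.2⟩

theorem isPeriodic_univ {s : ℕ} (Q : ℕ) : IsPeriodic Q (Set.univ : Set (Fin s → ℤ)) :=
  fun _ _ _ _ => trivial

theorem periodDensity_biInter {s : ℕ} {ι : Type*} (I : Finset ι) (Q : ι → ℕ)
    (T : ι → Set (Fin s → ℤ)) (hT : ∀ i ∈ I, IsPeriodic (Q i) (T i))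
    (hQ : (I : Set ι).Pairwise fun i j => (Q i).Coprime (Q j)) :
    IsPeriodic (∏ i ∈ I, Q i) (⋂ i ∈ I, T i) ∧
      periodDensity (∏ i ∈ I, Q i) (⋂ i ∈ I, T i) = ∏ i ∈ I, periodDensity (Q i) (T i) := by
  classical
  induction I using Finset.induction_on with
  | empty =>
    simp only [Finset.notMem_empty, Set.iInter_of_empty, Set.iInter_univ, Finset.prod_empty]
    exact ⟨isPeriodic_univ _, periodDensity_one_univ s⟩
  | insert i I hi ih =>
    obtain ⟨h1, h2⟩ := ih (fun j hj => hT j (Finset.mem_insert_of_mem hj))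
      (hQ.mono (by simp))
    have hTi := hT i (Finset.mem_insert_self _ _)
    have hcop : (Q i).Coprime (∏ j ∈ I, Q j) := Nat.Coprime.prod_right fun j hj =>
      hQ (by simp) (by simp [hj]) (by rintro rfl; exact hi hj)
    rw [Finset.set_biInter_insert, Finset.prod_insert hi, Finset.prod_insert hi, ← h2]
    exact ⟨(hTi.of_dvd (dvd_mul_right _ _)).inter (h1.of_dvd (dvd_mul_left _ _)),
      periodDensity_inter hcop hTi h1⟩

/-- The nonzero multiples of `m` of absolute value at most `A`. -/
theorem ncard_multiples_le {m : ℕ} (hm : 0 < m) {A : ℝ} (hA : 0 ≤ A) :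
    ({n : ℤ | n ≠ 0 ∧ (m : ℤ) ∣ n ∧ |(n : ℝ)| ≤ A}.ncard : ℝ) ≤ 2 * A / m := by
  have hm0 : (0 : ℝ) < m := by exact_mod_cast hm
  set K : ℕ := ⌊A / m⌋₊ with hK
  have hsub : {n : ℤ | n ≠ 0 ∧ (m : ℤ) ∣ n ∧ |(n : ℝ)| ≤ A} ⊆
      (fun t : ℤ => (m : ℤ) * t) '' (((Finset.Icc (-(K : ℤ)) K).erase 0 : Finset ℤ) : Set ℤ) := by
    rintro n ⟨h0, ⟨t, rfl⟩, h2⟩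
    refine ⟨t, ?_, rfl⟩
    have ht0 : t ≠ 0 := by rintro rfl; simp at h0
    push_cast at h2
    rw [abs_mul, abs_of_pos hm0, ← le_div_iff₀' hm0] at h2
    have h3 : t.natAbs ≤ K := by
      apply Nat.le_floor
      rw [Nat.cast_natAbs]
      push_cast
      exact h2
    simp only [Finset.coe_erase, Finset.coe_Icc, Set.mem_sdiff, Set.mem_Icc,
      Set.mem_singleton_iff]
    omega
  have h1 := (Set.ncard_le_ncard hsub (Set.toFinite _)).trans (Set.ncard_image_le (Set.toFinite _))
  rw [Set.ncard_coe_finset, Finset.card_erase_of_mem (by simp), Int.card_Icc] at h1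
  have h2 : {n : ℤ | n ≠ 0 ∧ (m : ℤ) ∣ n ∧ |(n : ℝ)| ≤ A}.ncard ≤ 2 * K := by omega
  have h3 : (K : ℝ) ≤ A / m := Nat.floor_le (by positivity)
  calc (_ : ℝ) ≤ ((2 * K : ℕ) : ℝ) := by exact_mod_cast h2
    _ ≤ 2 * A / m := by push_cast; rw [mul_div_assoc]; linarith

/-- Since zero is excluded there is no additive boundary term, so the bound holds for every modulus,
even beyond `A`. This uniformity permits summation over primes. -/
theorem boxCount_multiples_le {s : ℕ} (m : Fin s → ℕ) (hm : ∀ j, 0 < m j) {A : ℝ} (hA : 0 ≤ A) :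
    (boxCount {a : Fin s → ℤ | ∀ j, a j ≠ 0 ∧ (m j : ℤ) ∣ a j} A : ℝ) ≤ ∏ j, (2 * A / m j) := by
  have hfin : ∀ j, {n : ℤ | n ≠ 0 ∧ (m j : ℤ) ∣ n ∧ |(n : ℝ)| ≤ A}.Finite := fun j =>
    (finite_int_abs_le A).subset fun n hn => hn.2.2
  have hset : {a : Fin s → ℤ | ∀ j, a j ≠ 0 ∧ (m j : ℤ) ∣ a j} ∩ box s A =
      (Fintype.piFinset fun j => (hfin j).toFinset : Finset _) := by
    ext a
    simp only [box, Set.mem_inter_iff, Set.mem_ofPred_eq, Finset.mem_coe, Fintype.mem_piFinset,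
      Set.Finite.mem_toFinset]
    exact ⟨fun h j => ⟨(h.1 j).1, (h.1 j).2, h.2 j⟩,
      fun h => ⟨fun j => ⟨(h j).1, (h j).2.1⟩, fun j => (h j).2.2⟩⟩
  rw [boxCount_eq, hset, Set.ncard_coe_finset, Fintype.card_piFinset]
  push_cast
  refine Finset.prod_le_prod (fun _ _ => by positivity) fun j _ => ?_
  rw [← Set.ncard_eq_toFinset_card _ (hfin j)]
  exact ncard_multiples_le (hm j) hA

/-! ### Solubility in `p`-adic units and in positive reals -/

/-- Integer tuples, zeros allowed, for which the equation is soluble in `p`-adic units. -/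
def unitSoluble (k s p : ℕ) [Fact p.Prime] : Set (Fin s → ℤ) :=
  {a | ∃ x : Fin s → (ℤ_[p])ˣ, ∑ j, (a j : ℤ_[p]) * (x j : ℤ_[p]) ^ k = 0}

/-- The soluble tuples that are not divisible by `p ^ n`. -/
def levelSet (k s p n : ℕ) [Fact p.Prime] : Set (Fin s → ℤ) :=
  {a | (∃ j, ¬ ((p ^ n : ℕ) : ℤ) ∣ a j) ∧ a ∈ unitSoluble k s p}

theorem mem_padicSoluble {k s : ℕ} {p : Nat.Primes} {a : Fin s → ℤ} :
    a ∈ padicSoluble k s p ↔ (∀ j, a j ≠ 0) ∧ a ∈ unitSoluble k s p := Iff.rfl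

/-- Hensel's lemma is applied in the single variable `x j`, the others being frozen. At a unit the
derivative has norm `‖k * a j‖`. -/
theorem exists_unit_solution_of_approx {p : ℕ} [Fact p.Prime] {k s : ℕ} (a : Fin s → ℤ_[p])
    (x : Fin s → (ℤ_[p])ˣ) (j : Fin s)
    (h : ‖∑ i, a i * (x i : ℤ_[p]) ^ k‖ < ‖(k : ℤ_[p]) * a j‖ ^ 2) :
    ∃ y : Fin s → (ℤ_[p])ˣ, ∑ i, a i * (y i : ℤ_[p]) ^ k = 0 := by
  classical
  let c := ∑ i ∈ Finset.univ.erase j, a i * (x i : ℤ_[p]) ^ k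
  let F : Polynomial ℤ_[p] := Polynomial.C (a j) * Polynomial.X ^ k + Polynomial.C c
  have hFe : ∀ z : ℤ_[p], Polynomial.aeval z F = a j * z ^ k + c := fun z => by simp [F]
  have hFd : Polynomial.aeval (x j : ℤ_[p]) (Polynomial.derivative F) =
      (k : ℤ_[p]) * a j * (x j : ℤ_[p]) ^ (k - 1) := by
    simp [F, Polynomial.derivative_X_pow]; ring
  have hn : ‖Polynomial.aeval (x j : ℤ_[p]) (Polynomial.derivative F)‖ = ‖(k : ℤ_[p]) * a j‖ := by
    rw [hFd, norm_mul, norm_pow, PadicInt.isUnit_iff.1 (x j).isUnit, one_pow, mul_one]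
  have hsum : ∀ i0 : ℤ_[p], i0 = (x j : ℤ_[p]) →
      a j * i0 ^ k + c = ∑ i, a i * (x i : ℤ_[p]) ^ k := by
    rintro _ rfl
    exact Finset.add_sum_erase _ (fun i => a i * (x i : ℤ_[p]) ^ k) (Finset.mem_univ j)
  obtain ⟨z, hz, hzx, -⟩ := hensels_lemma (F := F) (a := (x j : ℤ_[p]))
    (by rw [hn, hFe, hsum _ rfl]; exact h)
  -- The root is closer to `x j` than 1, so the ultrametric inequality keeps it a unit.
  have hzu : IsUnit z := by
    rw [PadicInt.isUnit_iff]
    have h1 : ‖z - x j‖ < ‖(x j : ℤ_[p])‖ := by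
      rw [PadicInt.isUnit_iff.1 (x j).isUnit]
      exact hzx.trans_le (PadicInt.norm_le_one _)
    have h2 := IsUltrametricDist.norm_add_eq_max_of_norm_ne_norm h1.ne
    rw [sub_add_cancel, max_eq_right h1.le] at h2
    rw [h2]; exact PadicInt.isUnit_iff.1 (x j).isUnit
  refine ⟨Function.update x j hzu.unit, ?_⟩
  rw [← Finset.add_sum_erase _ _ (Finset.mem_univ j), Function.update_self]
  rw [hFe] at hz
  rw [IsUnit.unit_spec, ← hz]
  congr 1
  refine Finset.sum_congr rfl fun i hi => ?_
  rw [Function.update_of_ne (Finset.ne_of_mem_erase hi)]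

/-- Keep the solution for `a` as an approximate solution for `b`. Some `b j` is not divisible by `p
^ n`, and `p ^ k ∤ k` because `k < p ^ k`; hence `‖k * b j‖ ^ 2` exceeds `p ^ (-(2n + 2k))`, and
Hensel applies even when `p ∣ k`. -/
theorem isPeriodic_levelSet {k : ℕ} (hk : k ≠ 0) (s p n : ℕ) [hp : Fact p.Prime] :
    IsPeriodic (p ^ (2 * n + 2 * k)) (levelSet k s p n) := by
  rintro a b hab ⟨⟨j, hj⟩, x, hx⟩
  have hp0 : (0 : ℝ) < p := by exact_mod_cast hp.out.pos
  have hdvd : ∀ i, ((p ^ (2 * n + 2 * k) : ℕ) : ℤ) ∣ b i - a i := fun i => by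
    rw [← ZMod.intCast_zmod_eq_zero_iff_dvd]
    push_cast
    rw [hab i, sub_self]
  have hj' : ¬ ((p ^ n : ℕ) : ℤ) ∣ b j := fun h => hj <| by
    have h1 : ((p ^ n : ℕ) : ℤ) ∣ b j - a j :=
      dvd_trans (by exact_mod_cast pow_dvd_pow p (by omega)) (hdvd j)
    have := dvd_sub h h1
    simpa using this
  refine ⟨⟨j, hj'⟩, ?_⟩
  apply exists_unit_solution_of_approx (fun i => (b i : ℤ_[p])) x j
  have h1 : ‖∑ i, (b i : ℤ_[p]) * (x i : ℤ_[p]) ^ k‖ ≤ (p : ℝ) ^ (-((2 * n + 2 * k : ℕ) : ℤ)) := by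
    have : ∑ i, (b i : ℤ_[p]) * (x i : ℤ_[p]) ^ k =
        ∑ i, ((b i - a i : ℤ) : ℤ_[p]) * (x i : ℤ_[p]) ^ k := by
      push_cast
      simp_rw [sub_mul]
      rw [Finset.sum_sub_distrib, hx, sub_zero]
    rw [this]
    refine IsUltrametricDist.norm_sum_le_of_forall_le_of_nonneg (by positivity) fun i _ => ?_
    rw [norm_mul, norm_pow, PadicInt.isUnit_iff.1 (x i).isUnit, one_pow, mul_one,
      PadicInt.norm_int_le_pow_iff_dvd]
    exact_mod_cast hdvd i
  have h2 : (p : ℝ) ^ (-(n : ℤ)) < ‖(b j : ℤ_[p])‖ := by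
    rw [← not_le, PadicInt.norm_int_le_pow_iff_dvd]
    exact_mod_cast hj'
  have h3 : (p : ℝ) ^ (-(k : ℤ)) < ‖(k : ℤ_[p])‖ := by
    rw [← not_le, ← Int.cast_natCast (R := ℤ_[p]) k, PadicInt.norm_int_le_pow_iff_dvd]
    intro h
    have h' : p ^ k ∣ k := by exact_mod_cast h
    exact absurd (Nat.le_of_dvd (Nat.pos_of_ne_zero hk) h')
      (not_le.2 (Nat.lt_pow_self hp.out.one_lt))
  refine h1.trans_lt ?_
  have e : (p : ℝ) ^ (-((2 * n + 2 * k : ℕ) : ℤ)) =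
      ((p : ℝ) ^ (-(k : ℤ)) * (p : ℝ) ^ (-(n : ℤ))) ^ 2 := by
    rw [← zpow_add₀ hp0.ne', ← zpow_natCast, ← zpow_mul]
    congr 1; push_cast; ring
  rw [e, norm_mul]
  gcongr

theorem toZMod_eq_zero_iff {p : ℕ} [Fact p.Prime] (z : ℤ_[p]) :
    PadicInt.toZMod z = 0 ↔ ‖z‖ < 1 := by
  rw [← RingHom.mem_ker, PadicInt.ker_toZMod, IsLocalRing.mem_maximalIdeal, PadicInt.mem_nonunits]

/-- For `p ∤ k` the primitive soluble tuples are detected modulo `p`. -/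
theorem mem_levelSet_one_iff {k s p : ℕ} [hp : Fact p.Prime] (hpk : ¬ p ∣ k) (a : Fin s → ℤ) :
    a ∈ levelSet k s p 1 ↔ (∃ j, (a j : ZMod p) ≠ 0) ∧
      ∃ x : Fin s → (ZMod p)ˣ, ∑ j, (a j : ZMod p) * (x j : ZMod p) ^ k = 0 := by
  have e : (∃ j, (a j : ZMod p) ≠ 0) ↔ ∃ j, ¬ ((p ^ 1 : ℕ) : ℤ) ∣ a j := by
    simp only [pow_one, ← ZMod.intCast_zmod_eq_zero_iff_dvd, ne_eq]
  rw [e]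
  refine and_congr_right fun ⟨j, hj⟩ => ?_
  rw [pow_one] at hj
  constructor
  · rintro ⟨x, hx⟩
    refine ⟨fun i => Units.map PadicInt.toZMod.toMonoidHom (x i), ?_⟩
    have := congrArg (PadicInt.toZMod (p := p)) hx
    simpa using this
  · rintro ⟨x, hx⟩
    have hlift : ∀ u : (ZMod p)ˣ, ∃ y : (ℤ_[p])ˣ, PadicInt.toZMod (y : ℤ_[p]) = (u : ZMod p) := by
      intro u
      have h1 : PadicInt.toZMod (((u : ZMod p).val : ℕ) : ℤ_[p]) = (u : ZMod p) := by
        rw [map_natCast, ZMod.natCast_zmod_val]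
      have h2 : IsUnit (((u : ZMod p).val : ℕ) : ℤ_[p]) := by
        by_contra hcon
        rw [← mem_nonunits_iff, PadicInt.mem_nonunits, ← toZMod_eq_zero_iff, h1] at hcon
        exact u.ne_zero hcon
      exact ⟨h2.unit, h1⟩
    choose y hy using hlift
    apply exists_unit_solution_of_approx (fun i => (a i : ℤ_[p])) (fun i => y (x i)) j
    have hk1 : ‖(k : ℤ_[p])‖ = 1 := by
      refine le_antisymm (PadicInt.norm_le_one _) (not_lt.1 fun h => hpk ?_)
      rw [← Int.cast_natCast (R := ℤ_[p]) k, PadicInt.norm_int_lt_one_iff_dvd] at h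
      exact_mod_cast h
    have ha1 : ‖(a j : ℤ_[p])‖ = 1 := by
      refine le_antisymm (PadicInt.norm_le_one _) (not_lt.1 fun h => hj ?_)
      rwa [PadicInt.norm_int_lt_one_iff_dvd] at h
    rw [norm_mul, hk1, ha1, mul_one, one_pow, ← toZMod_eq_zero_iff]
    simpa [hy] using hx

theorem isPeriodic_levelSet_one {k s p : ℕ} [hp : Fact p.Prime] (hpk : ¬ p ∣ k) :
    IsPeriodic p (levelSet k s p 1) := by
  intro a b hab
  rw [mem_levelSet_one_iff hpk, mem_levelSet_one_iff hpk]
  simp only [hab]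
  exact id

/-- The sign patterns taking both signs. -/
def mixedSigns (s : ℕ) : Finset (Fin s → Bool) :=
  Finset.univ \ {fun _ => true, fun _ => false}

theorem mem_mixedSigns {s : ℕ} {ε : Fin s → Bool} :
    ε ∈ mixedSigns s ↔ (∃ i, ε i = true) ∧ ∃ i, ε i = false := by
  simp only [mixedSigns, Finset.mem_sdiff, Finset.mem_univ, true_and, Finset.mem_insert,
    Finset.mem_singleton, not_or, funext_iff, not_forall, Bool.not_eq_true, Bool.not_eq_false]
  exact and_comm

theorem card_mixedSigns {s : ℕ} (hs : 0 < s) :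
    ((mixedSigns s).card : ℝ) = deltaInfty s * 2 ^ s := by
  have hne : (fun _ => true : Fin s → Bool) ≠ fun _ => false := fun h => by
    simpa using congrFun h ⟨0, hs⟩
  have h1 : (mixedSigns s).card = 2 ^ s - 2 := by
    rw [mixedSigns, Finset.card_sdiff_of_subset (Finset.subset_univ _), Finset.card_pair hne]
    simp
  have h2 : 2 ≤ 2 ^ s := by
    calc 2 = 2 ^ 1 := rfl
      _ ≤ 2 ^ s := Nat.pow_le_pow_right (by norm_num) hs
  rw [h1, Nat.cast_sub h2, deltaInfty, sub_mul, zpow_sub₀ (by norm_num)]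
  simp

theorem realSoluble_eq_signed {k s : ℕ} (hk : k ≠ 0) (hs : 0 < s) :
    realSoluble k s = signed (mixedSigns s) := by
  ext a
  simp only [realSoluble, signed, Set.mem_ofPred_eq, mem_mixedSigns, decide_eq_true_eq,
    decide_eq_false_iff_not]
  refine and_congr_right fun ha => ⟨?_, ?_⟩
  · rintro ⟨x, hx, hsum⟩
    have hne : (Finset.univ : Finset (Fin s)).Nonempty := ⟨⟨0, hs⟩, Finset.mem_univ _⟩
    constructor
    · by_contra! h
      have : ∑ j, (a j : ℝ) * x j ^ k < 0 := Finset.sum_neg (fun j _ => by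
        have h1 : (a j : ℝ) < 0 := by exact_mod_cast lt_of_le_of_ne (h j) (ha j)
        exact mul_neg_of_neg_of_pos h1 (pow_pos (hx j) k)) hne
      exact this.ne hsum
    · by_contra! h
      have : 0 < ∑ j, (a j : ℝ) * x j ^ k := Finset.sum_pos (fun j _ => by
        have h1 : (0 : ℝ) < (a j : ℝ) := by exact_mod_cast h j
        exact mul_pos h1 (pow_pos (hx j) k)) hne
      exact this.ne' hsum
  · rintro ⟨⟨i, hi⟩, ⟨i', hi'⟩⟩
    set P : Finset (Fin s) := Finset.univ.filter fun j => 0 < a j with hP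
    set N : Finset (Fin s) := Finset.univ.filter fun j => ¬ 0 < a j with hN
    have hPc : (0 : ℝ) < P.card := by
      exact_mod_cast Finset.card_pos.2 ⟨i, by simp [hP, hi]⟩
    have hNc : (0 : ℝ) < N.card := by
      exact_mod_cast Finset.card_pos.2 ⟨i', by simpa [hN] using hi'⟩
    -- With `y j` as the `k`-th power of `x j`, the positive terms share a total of `1` equally and
    -- the negative terms a total of `-1`.
    let y : Fin s → ℝ := fun j => if 0 < a j then (|(a j : ℝ)| * P.card)⁻¹ else (|(a j : ℝ)| * N.card)⁻¹
    have hy : ∀ j, 0 < y j := fun j => by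
      have : 0 < |(a j : ℝ)| := abs_pos.2 (by exact_mod_cast ha j)
      dsimp only [y]; split_ifs <;> positivity
    refine ⟨fun j => y j ^ ((k : ℝ)⁻¹), fun j => Real.rpow_pos_of_pos (hy j) _, ?_⟩
    simp_rw [Real.rpow_inv_natCast_pow (hy _).le hk]
    rw [← Finset.sum_filter_add_sum_filter_not Finset.univ (fun j => 0 < a j)]
    rw [Finset.sum_congr (g := fun _ => (P.card : ℝ)⁻¹) rfl, Finset.sum_congr (s₁ := Finset.univ.filter fun j => ¬ 0 < a j) (g := fun _ => -(N.card : ℝ)⁻¹) rfl]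
    · rw [Finset.sum_const, Finset.sum_const, ← hP, ← hN]
      simp [hPc.ne', hNc.ne']
    · intro j hj
      have hj' := (Finset.mem_filter.1 hj).2
      have h1 : (a j : ℝ) < 0 := by exact_mod_cast lt_of_le_of_ne (not_lt.1 hj') (ha j)
      simp only [y, if_neg hj', abs_of_neg h1]
      field_simp
      rw [div_self h1.ne]
    · intro j hj
      have hj' := (Finset.mem_filter.1 hj).2
      have h1 : (0 : ℝ) < (a j : ℝ) := by exact_mod_cast hj'
      simp only [y, if_pos hj', abs_of_pos h1]
      field_simp

/-! ### Diagonal equations in three variables over a prime field -/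

/-- The exponential sum over `k`-th powers of units. -/
def powerSum (p k : ℕ) [Fact p.Prime] (t : ZMod p) : ℂ :=
  ∑ x : (ZMod p)ˣ, ZMod.stdAddChar (t * (x : ZMod p) ^ k)

theorem powerSum_zero (p k : ℕ) [Fact p.Prime] : powerSum p k 0 = (p - 1 : ℕ) := by
  simp [powerSum, Nat.totient_prime (Fact.out : p.Prime)]

theorem powerSum_mul_pow (p k : ℕ) [Fact p.Prime] (t : ZMod p) (y : (ZMod p)ˣ) :
    powerSum p k (t * (y : ZMod p) ^ k) = powerSum p k t := by
  unfold powerSum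
  rw [← Equiv.sum_comp (Equiv.mulLeft y) (fun x : (ZMod p)ˣ => ZMod.stdAddChar (t * (x : ZMod p) ^ k))]
  refine Finset.sum_congr rfl fun x _ => ?_
  simp [mul_pow, mul_assoc]

theorem card_units_pow_eq_le {p k : ℕ} [Fact p.Prime] (hk : 0 < k) (c : ZMod p) :
    (Finset.univ.filter fun x : (ZMod p)ˣ => (x : ZMod p) ^ k = c).card ≤ k := by
  refine (Finset.card_le_card_of_injOn (t := (Polynomial.nthRoots k c).toFinset)
    (fun x : (ZMod p)ˣ => (x : ZMod p)) (fun x hx => ?_) Units.val_injective.injOn).trans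
    ((Multiset.toFinset_card_le _).trans (Polynomial.card_nthRoots k c))
  rw [Finset.mem_coe, Multiset.mem_toFinset, Polynomial.mem_nthRoots hk]
  exact (Finset.mem_filter.1 hx).2

/-- Parseval: by orthogonality the sum is `p` times the number of pairs of units with `x ^ k = y ^
k`, and each `x` admits at most `k` values of `y`. -/
theorem sum_sq_norm_powerSum {p k : ℕ} [Fact p.Prime] (hk : 0 < k) :
    ∑ t : ZMod p, ‖powerSum p k t‖ ^ 2 ≤ p * ((p - 1 : ℕ) * k) := by
  classical
  have h1 : ∀ t : ZMod p, ((‖powerSum p k t‖ ^ 2 : ℝ) : ℂ) =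
      ∑ x : (ZMod p)ˣ, ∑ y : (ZMod p)ˣ,
        ZMod.stdAddChar (t * ((x : ZMod p) ^ k - (y : ZMod p) ^ k)) := by
    intro t
    rw [← Complex.normSq_eq_norm_sq, Complex.normSq_eq_conj_mul_self, mul_comm, powerSum, map_sum,
      Finset.sum_mul_sum]
    refine Finset.sum_congr rfl fun x _ => Finset.sum_congr rfl fun y _ => ?_
    rw [← AddChar.map_neg_eq_conj, ← AddChar.map_add_eq_mul]
    congr 1; ring
  have h2 : ((∑ t : ZMod p, ‖powerSum p k t‖ ^ 2 : ℝ) : ℂ) =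
      ((∑ x : (ZMod p)ˣ, p * ((Finset.univ.filter fun y : (ZMod p)ˣ =>
        (y : ZMod p) ^ k = (x : ZMod p) ^ k).card) : ℕ) : ℂ) := by
    rw [Complex.ofReal_sum, Finset.sum_congr rfl fun t _ => h1 t, Finset.sum_comm]
    push_cast
    refine Finset.sum_congr rfl fun x _ => ?_
    rw [Finset.sum_comm]
    simp_rw [AddChar.sum_mulShift _ (ZMod.isPrimitive_stdAddChar p), ZMod.card]
    rw [Finset.card_filter, Nat.cast_sum, Finset.mul_sum]
    refine Finset.sum_congr rfl fun y _ => ?_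
    by_cases h : (y : ZMod p) ^ k = (x : ZMod p) ^ k
    · simp [h]
    · simp [h, sub_eq_zero, Ne.symm h]
  have h3 : (∑ t : ZMod p, ‖powerSum p k t‖ ^ 2 : ℝ) =
      ((∑ x : (ZMod p)ˣ, p * ((Finset.univ.filter fun y : (ZMod p)ˣ =>
        (y : ZMod p) ^ k = (x : ZMod p) ^ k).card) : ℕ) : ℝ) := by exact_mod_cast h2
  rw [h3]
  have h4 : (∑ x : (ZMod p)ˣ, p * ((Finset.univ.filter fun y : (ZMod p)ˣ =>
        (y : ZMod p) ^ k = (x : ZMod p) ^ k).card)) ≤ p * ((p - 1) * k) := by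
    refine (Finset.sum_le_sum fun x _ => Nat.mul_le_mul_left p (card_units_pow_eq_le hk _)).trans ?_
    rw [Finset.sum_const, Finset.card_univ, ZMod.card_units]
    apply le_of_eq; simp only [smul_eq_mul]; ring
  exact_mod_cast h4

/-- The sum is unchanged when `t` is multiplied by a `k`-th power of a unit. As `y` runs over the `p
- 1` units, `t * y ^ k` takes each value at most `k` times, so the mean square bound turns into a
pointwise one. -/
theorem sq_norm_powerSum_le {p k : ℕ} [hp : Fact p.Prime] (hk : 0 < k) {t : ZMod p} (ht : t ≠ 0) :
    ‖powerSum p k t‖ ^ 2 ≤ p * (k : ℝ) ^ 2 := by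
  classical
  have hp1 : (0 : ℝ) < (p - 1 : ℕ) := by exact_mod_cast Nat.sub_pos_of_lt hp.out.one_lt
  have h1 : ((p - 1 : ℕ) : ℝ) * ‖powerSum p k t‖ ^ 2 =
      ∑ u : ZMod p, ∑ y ∈ Finset.univ.filter (fun y : (ZMod p)ˣ => t * (y : ZMod p) ^ k = u),
        ‖powerSum p k u‖ ^ 2 := by
    have : ∀ u : ZMod p, ∑ y ∈ Finset.univ.filter (fun y : (ZMod p)ˣ => t * (y : ZMod p) ^ k = u),
        ‖powerSum p k u‖ ^ 2 =
        ∑ y ∈ Finset.univ.filter (fun y : (ZMod p)ˣ => t * (y : ZMod p) ^ k = u),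
          ‖powerSum p k t‖ ^ 2 := fun u => Finset.sum_congr rfl fun y hy => by
      rw [← (Finset.mem_filter.1 hy).2, powerSum_mul_pow]
    simp_rw [this]
    rw [Finset.sum_fiberwise]
    simp [Nat.totient_prime hp.out]
  have h2 : ((p - 1 : ℕ) : ℝ) * ‖powerSum p k t‖ ^ 2 ≤ ∑ u : ZMod p, k * ‖powerSum p k u‖ ^ 2 := by
    rw [h1]
    refine Finset.sum_le_sum fun u _ => ?_
    rw [Finset.sum_const, nsmul_eq_mul]
    gcongr
    have : (Finset.univ.filter (fun y : (ZMod p)ˣ => t * (y : ZMod p) ^ k = u)) =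
        Finset.univ.filter (fun y : (ZMod p)ˣ => (y : ZMod p) ^ k = t⁻¹ * u) := by
      ext y
      simp only [Finset.mem_filter, Finset.mem_univ, true_and]
      rw [eq_inv_mul_iff_mul_eq₀ ht]
    rw [this]
    exact card_units_pow_eq_le hk _
  rw [← Finset.mul_sum] at h2
  have h3 := h2.trans (mul_le_mul_of_nonneg_left (sum_sq_norm_powerSum (p := p) hk)
    (Nat.cast_nonneg k))
  have h4 : ((p - 1 : ℕ) : ℝ) * ‖powerSum p k t‖ ^ 2 ≤ ((p - 1 : ℕ) : ℝ) * (p * (k : ℝ) ^ 2) := by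
    refine h3.trans (le_of_eq ?_); ring
  exact le_of_mul_le_mul_left h4 hp1

/-- If there were no solution, the term `(p - 1) ^ 3` at frequency zero would be cancelled by `p -
1` terms of size at most `(k √p) ^ 3`. Thus `(p - 1) ^ 4 ≤ p ^ 3 * k ^ 6`, and `p - 1 ≥ p / 2`
yields `p ≤ 16 * k ^ 6`. -/
theorem exists_unit_solution_three {p k : ℕ} [hp : Fact p.Prime] (hk : 0 < k)
    (hpk : 16 * k ^ 6 < p) {a b c : ZMod p} (ha : a ≠ 0) (hb : b ≠ 0) (hc : c ≠ 0) (d : ZMod p) :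
    ∃ x y z : (ZMod p)ˣ, a * (x : ZMod p) ^ k + b * (y : ZMod p) ^ k + c * (z : ZMod p) ^ k = d := by
  classical
  by_contra! hno
  have hsum : ∑ t : ZMod p, powerSum p k (a * t) * powerSum p k (b * t) * powerSum p k (c * t) *
      ZMod.stdAddChar (-(d * t)) = 0 := by
    have h1 : ∀ t : ZMod p, powerSum p k (a * t) * powerSum p k (b * t) * powerSum p k (c * t) *
        ZMod.stdAddChar (-(d * t)) = ∑ x : (ZMod p)ˣ, ∑ y : (ZMod p)ˣ, ∑ z : (ZMod p)ˣ,
          ZMod.stdAddChar (t * (a * (x : ZMod p) ^ k + b * (y : ZMod p) ^ k +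
            c * (z : ZMod p) ^ k - d)) := by
      intro t
      unfold powerSum
      rw [Finset.sum_mul_sum, Finset.sum_mul, Finset.sum_mul]
      refine Finset.sum_congr rfl fun x _ => ?_
      rw [Finset.sum_mul, Finset.sum_mul]
      refine Finset.sum_congr rfl fun y _ => ?_
      rw [Finset.mul_sum, Finset.sum_mul]
      refine Finset.sum_congr rfl fun z _ => ?_
      rw [← AddChar.map_add_eq_mul, ← AddChar.map_add_eq_mul, ← AddChar.map_add_eq_mul]
      congr 1; ring
    rw [Finset.sum_congr rfl fun t _ => h1 t, Finset.sum_comm]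
    refine Finset.sum_eq_zero fun x _ => ?_
    rw [Finset.sum_comm]
    refine Finset.sum_eq_zero fun y _ => ?_
    rw [Finset.sum_comm]
    refine Finset.sum_eq_zero fun z _ => ?_
    rw [AddChar.sum_mulShift _ (ZMod.isPrimitive_stdAddChar p),
      if_neg (sub_ne_zero.2 (hno x y z)), Nat.cast_zero]
  rw [← Finset.add_sum_erase _ _ (Finset.mem_univ 0)] at hsum
  simp only [mul_zero, neg_zero, AddChar.map_zero_eq_one, mul_one, powerSum_zero] at hsum
  have hp2 : 2 ≤ p := hp.out.two_le
  have hN : ((p - 1 : ℕ) : ℝ) ^ 3 ≤ (p - 1 : ℕ) * (√(p * (k : ℝ) ^ 2)) ^ 3 := by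
    have h1 : ((p - 1 : ℕ) : ℂ) * (p - 1 : ℕ) * (p - 1 : ℕ) =
        -∑ t ∈ Finset.univ.erase (0 : ZMod p), powerSum p k (a * t) * powerSum p k (b * t) *
          powerSum p k (c * t) * ZMod.stdAddChar (-(d * t)) := eq_neg_of_add_eq_zero_left hsum
    have h2 := congrArg norm h1
    rw [norm_neg] at h2
    have h3 : ((p - 1 : ℕ) : ℝ) ^ 3 = ‖((p - 1 : ℕ) : ℂ) * (p - 1 : ℕ) * (p - 1 : ℕ)‖ := by
      rw [norm_mul, norm_mul, Complex.norm_natCast]; ring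
    rw [h3, h2]
    have hb' : ∀ {e t : ZMod p}, e ≠ 0 → t ≠ 0 →
        ‖powerSum p k (e * t)‖ ≤ √(p * (k : ℝ) ^ 2) := fun he ht =>
      Real.le_sqrt_of_sq_le (sq_norm_powerSum_le hk (mul_ne_zero he ht))
    refine (norm_sum_le_of_le (n := fun _ => (√(p * (k : ℝ) ^ 2)) ^ 3) _ fun t ht => ?_).trans
      (le_of_eq ?_)
    · have ht0 := Finset.ne_of_mem_erase ht
      rw [norm_mul, norm_mul, norm_mul, AddChar.norm_apply, mul_one, pow_three']
      gcongr
      · exact hb' ha ht0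
      · exact hb' hb ht0
      · exact hb' hc ht0
    · rw [Finset.sum_const, Finset.card_erase_of_mem (Finset.mem_univ _), Finset.card_univ,
        ZMod.card, nsmul_eq_mul]
  have hm : ((p - 1 : ℕ) : ℝ) = (p : ℝ) - 1 := by rw [Nat.cast_sub (by omega)]; simp
  rw [hm] at hN
  have hpR : (2 : ℝ) ≤ p := by exact_mod_cast hp2
  have h1 : ((p : ℝ) - 1) ^ 2 ≤ (√(p * (k : ℝ) ^ 2)) ^ 3 := by
    have : ((p : ℝ) - 1) * ((p : ℝ) - 1) ^ 2 ≤ ((p : ℝ) - 1) * (√(p * (k : ℝ) ^ 2)) ^ 3 := by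
      linarith [hN, (by ring : ((p : ℝ) - 1) * ((p : ℝ) - 1) ^ 2 = ((p : ℝ) - 1) ^ 3)]
    exact le_of_mul_le_mul_left this (by linarith)
  have h2 : (((p : ℝ) - 1) ^ 2) ^ 2 ≤ (p * (k : ℝ) ^ 2) ^ 3 := by
    calc (((p : ℝ) - 1) ^ 2) ^ 2 ≤ ((√(p * (k : ℝ) ^ 2)) ^ 3) ^ 2 := by gcongr
      _ = ((√(p * (k : ℝ) ^ 2)) ^ 2) ^ 3 := by ring
      _ = _ := by rw [Real.sq_sqrt (by positivity)]
  have h3 : ((p : ℝ) / 2) ^ 4 ≤ (((p : ℝ) - 1) ^ 2) ^ 2 := by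
    rw [← pow_mul]
    gcongr
    linarith
  have h4 : (p : ℝ) ^ 3 * p ≤ (p : ℝ) ^ 3 * (16 * (k : ℝ) ^ 6) := by
    have := h3.trans h2
    have e1 : ((p : ℝ) / 2) ^ 4 = (p : ℝ) ^ 3 * p / 16 := by ring
    have e2 : (p * (k : ℝ) ^ 2) ^ 3 = (p : ℝ) ^ 3 * (k : ℝ) ^ 6 := by ring
    rw [e1, e2] at this
    linarith
  have h5 : (p : ℝ) ≤ 16 * (k : ℝ) ^ 6 := le_of_mul_le_mul_left h4 (by positivity)
  have h6 : p ≤ 16 * k ^ 6 := by exact_mod_cast h5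
  omega

/-- Large primes: three unit coefficients suffice. -/
theorem exists_unit_zero_of_three {p k s : ℕ} [hp : Fact p.Prime] (hk : 0 < k)
    (hpk : 16 * k ^ 6 < p) (a : Fin s → ZMod p)
    (h3 : 3 ≤ (Finset.univ.filter fun j => a j ≠ 0).card) :
    ∃ x : Fin s → (ZMod p)ˣ, ∑ j, a j * (x j : ZMod p) ^ k = 0 := by
  classical
  obtain ⟨u, hu, v, hv, w, hw, huv, huw, hvw⟩ := Finset.two_lt_card.1 h3
  simp only [Finset.mem_filter, Finset.mem_univ, true_and] at hu hv hw
  set J : Finset (Fin s) := ((Finset.univ.erase u).erase v).erase w with hJ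
  have split : ∀ f : Fin s → ZMod p, ∑ j, f j = f u + (f v + (f w + ∑ j ∈ J, f j)) := by
    intro f
    rw [hJ, Finset.add_sum_erase _ _ (by simp [huw.symm, hvw.symm]),
      Finset.add_sum_erase _ _ (by simp [huv.symm]), Finset.add_sum_erase _ _ (Finset.mem_univ _)]
  -- All remaining variables are set to 1 and moved to the right-hand side.
  obtain ⟨x, y, z, h⟩ := exists_unit_solution_three hk hpk hu hv hw (-∑ j ∈ J, a j)
  let X : Fin s → (ZMod p)ˣ :=
    Function.update (Function.update (Function.update (fun _ => 1) u x) v y) w z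
  refine ⟨X, ?_⟩
  rw [split]
  have e : ∑ j ∈ J, a j * (X j : ZMod p) ^ k = ∑ j ∈ J, a j := by
    refine Finset.sum_congr rfl fun j hj => ?_
    simp only [hJ, Finset.mem_erase] at hj
    dsimp only [X]
    rw [Function.update_of_ne hj.1, Function.update_of_ne hj.2.1, Function.update_of_ne hj.2.2.1]
    simp
  rw [e]
  dsimp only [X]
  rw [Function.update_self, Function.update_of_ne huw, Function.update_of_ne huv,
    Function.update_self, Function.update_of_ne hvw, Function.update_self]
  linear_combination h

/-! ### Local densities -/

theorem mem_signed_univ {s : ℕ} {a : Fin s → ℤ} :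
    a ∈ signed (Finset.univ : Finset (Fin s → Bool)) ↔ ∀ j, a j ≠ 0 := by
  simp [signed]

theorem hasDensity_of_isPeriodic {s Q : ℕ} (hQ : 0 < Q) {T : Set (Fin s → ℤ)}
    (hT : IsPeriodic Q T) (E : Finset (Fin s → Bool)) :
    HasDensity (T ∩ signed E) (E.card * periodDensity Q T / 2 ^ s) := by
  rw [HasDensity, tendsto_iff_norm_sub_tendsto_zero]
  have h0 : Tendsto (fun A : ℝ => E.card * periodDensity Q T * 3 ^ s / 2 ^ s * (Q / A))
      atTop (𝓝 0) := by
    have : Tendsto (fun A : ℝ => (Q : ℝ) / A) atTop (𝓝 0) := tendsto_const_nhds.div_atTop tendsto_id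
    simpa using this.const_mul (E.card * periodDensity Q T * 3 ^ s / 2 ^ s)
  refine squeeze_zero' (Eventually.of_forall fun _ => norm_nonneg _) ?_ h0
  filter_upwards [eventually_ge_atTop (Q : ℝ)] with A hA
  have hA0 : 0 < A := lt_of_lt_of_le (by exact_mod_cast hQ) hA
  have h := abs_boxCount_sub_le hQ hT E hA
  have e : boxProportion (T ∩ signed E) A - E.card * periodDensity Q T / 2 ^ s =
      ((boxCount (T ∩ signed E) A : ℝ) - E.card * periodDensity Q T * A ^ s) / (2 * A) ^ s := by
    rw [boxProportion, mul_pow]; field_simp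
  rw [Real.norm_eq_abs, e, abs_div, abs_of_pos (by positivity : 0 < (2 * A) ^ s),
    div_le_iff₀ (by positivity)]
  refine h.trans (le_of_eq ?_)
  rw [mul_pow]; field_simp

theorem hasDensity_univ_signed (s : ℕ) :
    HasDensity (signed (Finset.univ : Finset (Fin s → Bool))) 1 := by
  have := hasDensity_of_isPeriodic one_pos (isPeriodic_univ (s := s) 1) Finset.univ
  simpa [periodDensity_one_univ] using this

theorem hasDensity_realSoluble {k s : ℕ} (hk : k ≠ 0) (hs : 0 < s) :
    HasDensity (realSoluble k s) (deltaInfty s) := by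
  have := hasDensity_of_isPeriodic one_pos (isPeriodic_univ (s := s) 1) (mixedSigns s)
  rw [periodDensity_one_univ, card_mixedSigns hs, mul_one, mul_div_cancel_right₀ _ (by positivity),
    Set.univ_inter] at this
  rwa [realSoluble_eq_signed hk hs]

theorem deltaInfty_pos {s : ℕ} (hs : 2 ≤ s) : 0 < deltaInfty s := by
  have h : (2 : ℝ) ^ (1 - (s : ℤ)) ≤ 2 ^ (-1 : ℤ) := zpow_le_zpow_right₀ (by norm_num) (by omega)
  rw [deltaInfty]
  norm_num at h ⊢
  linarith

theorem deltaInfty_le_one (s : ℕ) : deltaInfty s ≤ 1 := by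
  rw [deltaInfty]
  have : (0 : ℝ) < 2 ^ (1 - (s : ℤ)) := by positivity
  linarith

/-- Cauchy's criterion. The constant may vary with `ε`, so the densities of the level sets can be
used without first showing that they converge in `n`. -/
theorem exists_tendsto_of_approx {f : ℝ → ℝ}
    (h : ∀ ε > 0, ∃ d, ∀ᶠ A in atTop, |f A - d| ≤ ε) : ∃ L, Tendsto f atTop (𝓝 L) := by
  rw [← cauchy_map_iff_exists_tendsto, Metric.cauchy_iff]
  refine ⟨inferInstance, fun ε hε => ?_⟩
  obtain ⟨d, hd⟩ := h (ε / 3) (by linarith)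
  refine ⟨f '' {A | |f A - d| ≤ ε / 3}, image_mem_map hd, ?_⟩
  rintro _ ⟨A, hA, rfl⟩ _ ⟨B, hB, rfl⟩
  rw [Real.dist_eq]
  have e : f A - f B = (f A - d) - (f B - d) := by ring
  rw [e]
  have hA' : |f A - d| ≤ ε / 3 := hA
  have hB' : |f B - d| ≤ ε / 3 := hB
  calc _ ≤ |f A - d| + |f B - d| := abs_sub _ _
    _ < ε := by linarith

theorem boxCount_all_multiples_le (s : ℕ) {m : ℕ} (hm : 0 < m) {A : ℝ} (hA : 0 ≤ A) :
    (boxCount {a : Fin s → ℤ | ∀ j, a j ≠ 0 ∧ (m : ℤ) ∣ a j} A : ℝ) ≤ (2 * A / m) ^ s := by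
  have := boxCount_multiples_le (s := s) (fun _ => m) (fun _ => hm) hA
  rwa [Finset.prod_const, Finset.card_univ, Fintype.card_fin] at this

theorem padicSoluble_subset {k s : ℕ} (p : Nat.Primes) (n : ℕ) :
    padicSoluble k s p ⊆ (levelSet k s p n ∩ signed Finset.univ) ∪
      {a | ∀ j, a j ≠ 0 ∧ (((p : ℕ) ^ n : ℕ) : ℤ) ∣ a j} := by
  intro a ha
  rw [mem_padicSoluble] at ha
  by_cases h : ∃ j, ¬ (((p : ℕ) ^ n : ℕ) : ℤ) ∣ a j
  · exact Or.inl ⟨⟨h, ha.2⟩, mem_signed_univ.2 ha.1⟩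
  · push Not at h
    exact Or.inr fun j => ⟨ha.1 j, h j⟩

theorem levelSet_inter_signed_subset {k s : ℕ} (p : Nat.Primes) (n : ℕ)
    (E : Finset (Fin s → Bool)) : levelSet k s p n ∩ signed E ⊆ padicSoluble k s p :=
  fun _ ha => ⟨ha.2.1, ha.1.2⟩

theorem abs_boxProportion_sub_le {k s : ℕ} (p : Nat.Primes) (n : ℕ) {A : ℝ} (hA : 0 < A) :
    |boxProportion (padicSoluble k s p) A -
      boxProportion (levelSet k s p n ∩ signed Finset.univ) A| ≤ (1 / ((p : ℕ) : ℝ) ^ n) ^ s := by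
  have hpn : 0 < (p : ℕ) ^ n := pow_pos p.2.pos n
  have h1 : (boxCount (levelSet k s p n ∩ signed Finset.univ) A : ℝ) ≤
      boxCount (padicSoluble k s p) A := by
    exact_mod_cast boxCount_mono (levelSet_inter_signed_subset p n _) A
  have h2 : (boxCount (padicSoluble k s p) A : ℝ) ≤
      boxCount (levelSet k s p n ∩ signed Finset.univ) A +
        boxCount {a : Fin s → ℤ | ∀ j, a j ≠ 0 ∧ (((p : ℕ) ^ n : ℕ) : ℤ) ∣ a j} A := by
    exact_mod_cast (boxCount_mono (padicSoluble_subset p n) A).trans (boxCount_union_le _ _ _)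
  have h3 := boxCount_all_multiples_le s hpn hA.le
  have hA2 : 0 < (2 * A) ^ s := by positivity
  rw [boxProportion, boxProportion, ← sub_div, abs_div, abs_of_nonneg (sub_nonneg.2 h1),
    abs_of_pos hA2, div_le_iff₀ hA2]
  rw [show (((p : ℕ) ^ n : ℕ) : ℝ) = ((p : ℕ) : ℝ) ^ n from Nat.cast_pow _ _] at h3
  rw [← mul_pow, one_div_mul_eq_div]
  linarith

theorem tendsto_one_div_pow_pow {p s : ℕ} (hp : 2 ≤ p) (hs : 0 < s) :
    Tendsto (fun n : ℕ => (1 / (p : ℝ) ^ n) ^ s) atTop (𝓝 0) := by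
  have h1 : Tendsto (fun n : ℕ => (1 / (p : ℝ) ^ n)) atTop (𝓝 0) := by
    have hp' : (2 : ℝ) ≤ p := by exact_mod_cast hp
    simp_rw [← one_div_pow]
    exact tendsto_pow_atTop_nhds_zero_of_lt_one (by positivity)
      (by rw [div_lt_one (by linarith)]; linarith)
  simpa [hs.ne'] using h1.pow s

theorem hasDensity_levelSet {k s : ℕ} {p : Nat.Primes} {n Q : ℕ} (hQ : 0 < Q)
    (h : IsPeriodic Q (levelSet k s p n)) :
    HasDensity (levelSet k s p n ∩ signed Finset.univ) (periodDensity Q (levelSet k s p n)) := by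
  have := hasDensity_of_isPeriodic hQ h Finset.univ
  simpa [Finset.card_univ] using this

theorem hasDensity_padicSoluble {k s : ℕ} (hk : k ≠ 0) (hs : 0 < s) (p : Nat.Primes) :
    HasDensity (padicSoluble k s p) (delta k s p) := by
  refine tendsto_nhds_limUnder (exists_tendsto_of_approx fun ε hε => ?_)
  obtain ⟨n, hn⟩ := ((tendsto_one_div_pow_pow p.2.two_le hs).eventually
    (gt_mem_nhds (half_pos hε))).exists
  have hper := isPeriodic_levelSet hk s p n
  have hd := hasDensity_levelSet (pow_pos p.2.pos _) hper
  refine ⟨periodDensity ((p : ℕ) ^ (2 * n + 2 * k)) (levelSet k s p n), ?_⟩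
  filter_upwards [eventually_gt_atTop (0 : ℝ), Metric.tendsto_nhds.1 hd (ε / 2) (half_pos hε)]
    with A hA hA2
  have h1 := abs_boxProportion_sub_le (k := k) (s := s) p n hA
  rw [Real.dist_eq] at hA2
  calc _ ≤ _ := abs_sub_le _ (boxProportion (levelSet k s p n ∩ signed Finset.univ) A) _
    _ ≤ ε := by linarith

theorem abs_delta_sub_le {k s : ℕ} (hk : k ≠ 0) (hs : 0 < s) (p : Nat.Primes) {n Q : ℕ}
    (hQ : 0 < Q) (hper : IsPeriodic Q (levelSet k s p n)) :
    |delta k s p - periodDensity Q (levelSet k s p n)| ≤ (1 / ((p : ℕ) : ℝ) ^ n) ^ s := by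
  refine le_of_tendsto ((hasDensity_padicSoluble hk hs p).sub (hasDensity_levelSet hQ hper)).abs ?_
  filter_upwards [eventually_gt_atTop (0 : ℝ)] with A hA
  exact abs_boxProportion_sub_le p n hA

/-- A soluble tuple either has a coefficient prime to `p` or is `p` times a soluble tuple from the
box of radius `A / p`. -/
theorem boxCount_padicSoluble_eq {k s : ℕ} (p : Nat.Primes) (A : ℝ) :
    boxCount (padicSoluble k s p) A = boxCount (levelSet k s p 1 ∩ signed Finset.univ) A +
      boxCount (padicSoluble k s p) (A / (p : ℕ)) := by
  have hp0 : ((p : ℕ) : ℤ) ≠ 0 := by exact_mod_cast p.2.ne_zero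
  have hpR : (0 : ℝ) < ((p : ℕ) : ℝ) := by exact_mod_cast p.2.pos
  let g : (Fin s → ℤ) → (Fin s → ℤ) := fun b j => (p : ℕ) * b j
  have hg : Function.Injective g := fun b c h => funext fun j =>
    mul_left_cancel₀ hp0 (congrFun h j)
  have hu : padicSoluble k s p ∩ box s A = ((levelSet k s p 1 ∩ signed Finset.univ) ∩ box s A) ∪
      g '' (padicSoluble k s p ∩ box s (A / (p : ℕ))) := by
    ext a
    constructor
    · rintro ⟨ha, hA⟩
      rcases padicSoluble_subset p 1 ha with h | h
      · exact Or.inl ⟨h, hA⟩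
      · right
        choose b hb using fun j => (h j).2
        simp only [pow_one] at hb
        obtain rfl : a = g b := funext hb
        refine ⟨b, ⟨⟨fun j hj => (h j).1 (by simp [g, hj]), ?_⟩, fun j => ?_⟩, rfl⟩
        · obtain ⟨x, hx⟩ := ha.2
          refine ⟨x, ?_⟩
          have hx' : ((p : ℕ) : ℤ_[(p : ℕ)]) * ∑ j, (b j : ℤ_[(p : ℕ)]) * (x j : ℤ_[(p : ℕ)]) ^ k
              = 0 := by
            rw [← hx, Finset.mul_sum]
            refine Finset.sum_congr rfl fun j _ => ?_
            simp only [g]; push_cast; ring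
          exact (mul_eq_zero.1 hx').resolve_left (by exact_mod_cast p.2.ne_zero)
        · have := hA j
          simp only [g] at this
          push_cast at this
          rw [abs_mul, abs_of_pos hpR] at this
          rwa [le_div_iff₀' hpR]
    · rintro (⟨h, hA⟩ | ⟨b, ⟨hb, hA⟩, rfl⟩)
      · exact ⟨levelSet_inter_signed_subset p 1 _ h, hA⟩
      · refine ⟨⟨fun j => mul_ne_zero hp0 (hb.1 j), ?_⟩, fun j => ?_⟩
        · obtain ⟨x, hx⟩ := hb.2
          refine ⟨x, ?_⟩
          rw [← mul_zero ((p : ℕ) : ℤ_[(p : ℕ)]), ← hx, Finset.mul_sum]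
          refine Finset.sum_congr rfl fun j _ => ?_
          simp only [g]; push_cast; ring
        · have := hA j
          simp only [g]
          push_cast
          rw [abs_mul, abs_of_pos hpR, ← le_div_iff₀' hpR]
          exact this
  have hdisj : Disjoint ((levelSet k s p 1 ∩ signed Finset.univ) ∩ box s A)
      (g '' (padicSoluble k s p ∩ box s (A / (p : ℕ)))) := by
    rw [Set.disjoint_left]
    rintro _ ⟨⟨⟨⟨j, hj⟩, -⟩, -⟩, -⟩ ⟨b, -, rfl⟩
    exact hj (by simp [g])
  rw [boxCount_eq, hu, Set.ncard_union_eq hdisj (finite_inter_box _ _)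
    ((finite_inter_box _ _).image _), Set.ncard_image_of_injective _ hg]
  rfl

/-- Passing to the limit in the preceding recursion gives `δ = d + δ * p ^ (-s)`, with `d` the
density of the tuples not divisible by `p`. -/
theorem delta_mul_eq {k s : ℕ} (hk : k ≠ 0) (hs : 0 < s) (p : Nat.Primes) {Q : ℕ}
    (hQ : 0 < Q) (hper : IsPeriodic Q (levelSet k s p 1)) :
    delta k s p * (1 - 1 / ((p : ℕ) : ℝ) ^ s) = periodDensity Q (levelSet k s p 1) := by
  have hpR : (0 : ℝ) < ((p : ℕ) : ℝ) := by exact_mod_cast p.2.pos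
  have hd := hasDensity_padicSoluble hk hs p
  have h1 := hasDensity_levelSet hQ hper
  have h2 : Tendsto (fun A : ℝ => boxProportion (padicSoluble k s p) (A / (p : ℕ))) atTop
      (𝓝 (delta k s p)) := hd.comp (tendsto_id.atTop_div_const hpR)
  have h3 := h1.add (h2.mul_const (1 / ((p : ℕ) : ℝ) ^ s))
  have h4 : Tendsto (boxProportion (padicSoluble k s p)) atTop
      (𝓝 (periodDensity Q (levelSet k s p 1) + delta k s p * (1 / ((p : ℕ) : ℝ) ^ s))) := by
    refine h3.congr' ?_
    filter_upwards [eventually_gt_atTop (0 : ℝ)] with A hA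
    simp only [boxProportion]
    rw [boxCount_padicSoluble_eq p A]
    push_cast
    rw [add_div]
    congr 1
    rw [div_mul_div_comm, mul_one, ← mul_pow, mul_assoc, div_mul_cancel₀ _ hpR.ne']
  have := tendsto_nhds_unique hd h4
  linarith

theorem levelSet_one_nonempty {k s : ℕ} (hs : 2 ≤ s) (p : Nat.Primes) :
    (levelSet k s p 1).Nonempty := by
  obtain ⟨m, rfl⟩ : ∃ m, s = m + 2 := ⟨s - 2, by omega⟩
  -- The coefficients sum to zero, so all variables equal to 1 is a solution, and a coefficient 1 is
  -- prime to `p`.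
  refine ⟨Fin.cons (-(m + 1 : ℤ)) fun _ => 1, ⟨1, ?_⟩, fun _ => 1, ?_⟩
  · rw [← Fin.succ_zero_eq_one, Fin.cons_succ, pow_one]
    intro h
    exact p.2.one_lt.ne' (by exact_mod_cast Int.eq_one_of_dvd_one (by positivity) h)
  · rw [Fin.sum_univ_succ]
    simp

theorem one_sub_pow_pos {p s : ℕ} (hp : 2 ≤ p) (hs : 0 < s) : 0 < 1 - 1 / (p : ℝ) ^ s := by
  have hp' : (1 : ℝ) < p := by exact_mod_cast hp
  have := one_lt_pow₀ hp' hs.ne'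
  rw [sub_pos, div_lt_one (by linarith)]
  exact this

theorem delta_pos {k s : ℕ} (hk : k ≠ 0) (hs : 2 ≤ s) (p : Nat.Primes) : 0 < delta k s p := by
  have hper := isPeriodic_levelSet hk s p 1
  have hQ : 0 < (p : ℕ) ^ (2 * 1 + 2 * k) := pow_pos p.2.pos _
  have h := delta_mul_eq hk (by omega) p hQ hper
  have h1 := periodDensity_pos hQ (levelSet_one_nonempty (k := k) hs p)
  rw [← h] at h1
  exact pos_of_mul_pos_left h1 (one_sub_pow_pos p.2.two_le (by omega)).le

theorem HasDensity.le {s : ℕ} {S T : Set (Fin s → ℤ)} {d d' e : ℝ} (hS : HasDensity S d)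
    (hT : HasDensity T d') (h : ∀ᶠ A in atTop, (boxCount S A : ℝ) ≤ boxCount T A + e * (2 * A) ^ s) :
    d ≤ d' + e := by
  refine le_of_tendsto_of_tendsto hS (hT.add_const e) ?_
  filter_upwards [h, eventually_gt_atTop 0] with A hA hA0
  have hA2 : 0 < (2 * A) ^ s := by positivity
  rw [boxProportion, boxProportion, div_add' _ _ _ hA2.ne', div_le_div_iff_of_pos_right hA2]
  exact hA

theorem delta_le_one {k s : ℕ} (hk : k ≠ 0) (hs : 0 < s) (p : Nat.Primes) : delta k s p ≤ 1 := by
  have := (hasDensity_padicSoluble hk hs p).le (hasDensity_univ_signed s) (e := 0)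
    (Eventually.of_forall fun A => by
      rw [zero_mul, add_zero]
      exact_mod_cast boxCount_mono (fun a (ha : a ∈ padicSoluble k s p) =>
        mem_signed_univ.2 ha.1) A)
  linarith

theorem mem_levelSet_one_of_three {k s p : ℕ} [Fact p.Prime] (hk : 0 < k) (hpk : 16 * k ^ 6 < p)
    (a : Fin s → ℤ) (h : 3 ≤ (Finset.univ.filter fun j => (a j : ZMod p) ≠ 0).card) :
    a ∈ levelSet k s p 1 := by
  have hkp : ¬ p ∣ k := fun hd => by
    have h1 := Nat.le_of_dvd hk hd
    have h2 : k ≤ k ^ 6 := Nat.le_self_pow (by norm_num) k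
    omega
  rw [mem_levelSet_one_iff hkp]
  refine ⟨?_, exists_unit_zero_of_three hk hpk _ h⟩
  obtain ⟨j, hj⟩ := Finset.card_pos.1 (by omega : 0 < (Finset.univ.filter fun j => (a j : ZMod p) ≠ 0).card)
  exact ⟨j, (Finset.mem_filter.1 hj).2⟩

/-- At most two coefficients are prime to `p`; their index set is enlarged to a pair `t`, outside
which `p` divides everything. -/
theorem insoluble_subset {k s : ℕ} (hk : 0 < k) (hs : 2 ≤ s) (p : Nat.Primes)
    (hpk : 16 * k ^ 6 < (p : ℕ)) :
    signed Finset.univ \ padicSoluble k s p ⊆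
      ⋃ t ∈ Finset.powersetCard 2 (Finset.univ : Finset (Fin s)),
        {a | ∀ j, a j ≠ 0 ∧ ((if j ∈ t then 1 else (p : ℕ) : ℕ) : ℤ) ∣ a j} := by
  rintro a ⟨ha, hna⟩
  have ha0 := mem_signed_univ.1 ha
  have hcard : (Finset.univ.filter fun j => (a j : ZMod p) ≠ 0).card ≤ 2 := by
    by_contra hcon
    exact hna ⟨ha0, (mem_levelSet_one_of_three hk hpk a (by omega)).2⟩
  obtain ⟨t, ht, -, htc⟩ := Finset.exists_subsuperset_card_eq
    (Finset.subset_univ _) hcard (by simpa using hs)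
  simp only [Set.mem_iUnion]
  refine ⟨t, Finset.mem_powersetCard.2 ⟨Finset.subset_univ _, htc⟩, fun j => ⟨ha0 j, ?_⟩⟩
  split_ifs with hj
  · simp
  · rw [← ZMod.intCast_zmod_eq_zero_iff_dvd]
    by_contra hne
    exact hj (ht (by simpa using hne))

theorem boxCount_insoluble_le {k s : ℕ} (hk : 0 < k) (hs : 2 ≤ s) (p : Nat.Primes)
    (hpk : 16 * k ^ 6 < (p : ℕ)) {A : ℝ} (hA : 0 ≤ A) :
    (boxCount (signed Finset.univ \ padicSoluble k s p) A : ℝ) ≤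
      s.choose 2 / ((p : ℕ) : ℝ) ^ (s - 2) * (2 * A) ^ s := by
  have h1 : (boxCount (signed Finset.univ \ padicSoluble k s p) A : ℝ) ≤
      ∑ t ∈ Finset.powersetCard 2 (Finset.univ : Finset (Fin s)),
        (boxCount {a : Fin s → ℤ | ∀ j, a j ≠ 0 ∧
          ((if j ∈ t then 1 else (p : ℕ) : ℕ) : ℤ) ∣ a j} A : ℝ) := by
    exact_mod_cast (boxCount_mono (insoluble_subset hk hs p hpk) A).trans
      (boxCount_biUnion_le _ _ _)
  refine h1.trans ((Finset.sum_le_sum (g := fun _ => (2 * A) ^ s / ((p : ℕ) : ℝ) ^ (s - 2))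
    fun t ht => ?_).trans (le_of_eq ?_))
  · refine (boxCount_multiples_le (fun j => if j ∈ t then 1 else (p : ℕ))
      (fun j => by split_ifs; exacts [one_pos, p.2.pos]) hA).trans (le_of_eq ?_)
    rw [Finset.prod_div_distrib, Finset.prod_const, Finset.card_univ, Fintype.card_fin]
    congr 1
    simp only [Nat.cast_ite, Nat.cast_one]
    rw [Finset.prod_ite, Finset.prod_const_one, one_mul, Finset.prod_const]
    congr 1
    rw [Finset.filter_not, Finset.card_sdiff_of_subset (Finset.filter_subset _ _)]
    simp [(Finset.mem_powersetCard.1 ht).2]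
  · rw [Finset.sum_const, Finset.card_powersetCard, Finset.card_univ, Fintype.card_fin,
      nsmul_eq_mul]
    ring

theorem one_sub_delta_le {k s : ℕ} (hk : 0 < k) (hs : 2 ≤ s) (p : Nat.Primes)
    (hpk : 16 * k ^ 6 < (p : ℕ)) :
    1 - delta k s p ≤ s.choose 2 / ((p : ℕ) : ℝ) ^ (s - 2) := by
  have := (hasDensity_univ_signed s).le (hasDensity_padicSoluble hk.ne' (by omega) p)
    (e := s.choose 2 / ((p : ℕ) : ℝ) ^ (s - 2)) (by
      filter_upwards [eventually_ge_atTop (0 : ℝ)] with A hA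
      have h1 : (boxCount (signed (Finset.univ : Finset (Fin s → Bool))) A : ℝ) ≤
          boxCount (padicSoluble k s p) A + boxCount (signed Finset.univ \ padicSoluble k s p) A := by
        exact_mod_cast (boxCount_mono (T := padicSoluble k s p ∪
          (signed Finset.univ \ padicSoluble k s p)) (by simp) A).trans (boxCount_union_le _ _ _)
      exact h1.trans (add_le_add_right (boxCount_insoluble_le hk hs p hpk hA) _))
  linarith

/-! ### The local density at large primes -/

/-- Nonzero tuples over `ZMod p` for which the diagonal equation is soluble in units. -/
def residueSoluble (k s p : ℕ) : Set (Fin s → ZMod p) :=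
  {r | (∃ j, r j ≠ 0) ∧ ∃ x : Fin s → (ZMod p)ˣ, ∑ j, r j * (x j : ZMod p) ^ k = 0}

theorem residues_levelSet_one {k s p : ℕ} [hp : Fact p.Prime] (hpk : ¬ p ∣ k) :
    residues p (levelSet k s p 1) = residueSoluble k s p := by
  ext r
  choose a ha using fun j => ZMod.intCast_surjective (r j)
  obtain rfl : r = fun j => (a j : ZMod p) := funext fun j => (ha j).symm
  rw [mem_residues_iff (isPeriodic_levelSet_one hpk), mem_levelSet_one_iff hpk]
  rfl

theorem card_units_not_pow (p k : ℕ) [hp : Fact p.Prime] :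
    ((((powMonoidHom k : (ZMod p)ˣ →* (ZMod p)ˣ).range : Set (ZMod p)ˣ)ᶜ.ncard : ℕ) : ℝ) =
      ((p : ℝ) - 1) * (1 - ((Nat.gcd (p - 1) k : ℕ) : ℝ)⁻¹) := by
  have h1 := Set.ncard_add_ncard_compl
    ((powMonoidHom k : (ZMod p)ˣ →* (ZMod p)ˣ).range : Set (ZMod p)ˣ)
  have h2 : ((powMonoidHom k : (ZMod p)ˣ →* (ZMod p)ˣ).range : Set (ZMod p)ˣ).ncard =
      (p - 1) / (p - 1).gcd k := by
    have := IsCyclic.card_powMonoidHom_range (ZMod p)ˣ k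
    rw [Nat.card_eq_fintype_card (α := (ZMod p)ˣ), ZMod.card_units] at this
    exact this
  have hg : 0 < (p - 1).gcd k := Nat.gcd_pos_of_pos_left _ (Nat.sub_pos_of_lt hp.out.one_lt)
  rw [h2, Nat.card_eq_fintype_card, ZMod.card_units] at h1
  have h3 := congrArg (Nat.cast : ℕ → ℝ) h1
  rw [Nat.cast_add, Nat.cast_div (Nat.gcd_dvd_left _ _) (by positivity),
    Nat.cast_sub hp.out.one_lt.le, Nat.cast_one] at h3
  rw [← eq_sub_iff_add_eq'] at h3
  rw [h3]
  ring

/-- Write the two nonzero entries as `-u * v` and `v`. The equation becomes `x j ^ k = u * x i ^ k`,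
soluble exactly when `u` is a `k`-th power, while `v` is free. -/
theorem card_pair_insoluble {k s p : ℕ} [hp : Fact p.Prime] {i j : Fin s} (hij : i ≠ j) :
    (({r : Fin s → ZMod p | (∀ l, r l ≠ 0 ↔ l = i ∨ l = j) ∧ r ∉ residueSoluble k s p}.ncard : ℕ) : ℝ)
      = ((p : ℝ) - 1) ^ 2 * (1 - ((Nat.gcd (p - 1) k : ℕ) : ℝ)⁻¹) := by
  classical
  let f : (ZMod p)ˣ × (ZMod p)ˣ → (Fin s → ZMod p) := fun w l =>
    if l = i then -(w.1 * w.2 : ZMod p) else if l = j then w.2 else 0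
  have hfi : ∀ w, f w i = -(w.1 * w.2 : ZMod p) := fun w => by simp [f]
  have hfj : ∀ w, f w j = w.2 := fun w => by simp [f, hij.symm]
  have hfl : ∀ w l, l ≠ i → l ≠ j → f w l = 0 := fun w l h1 h2 => by simp [f, h1, h2]
  have hinj : Function.Injective f := by
    rintro ⟨u, v⟩ ⟨u', v'⟩ h
    have hj : (v : ZMod p) = v' := by rw [← hfj (u, v), h, hfj]
    have hi : -(u * v : ZMod p) = -(u' * v' : ZMod p) := by rw [← hfi (u, v), h, hfi]
    obtain rfl := Units.ext hj
    have : (u : ZMod p) = u' := mul_right_cancel₀ v.ne_zero (neg_injective hi)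
    rw [Units.ext this]
  have hsolv : ∀ w, f w ∈ residueSoluble k s p ↔
      w.1 ∈ (powMonoidHom k : (ZMod p)ˣ →* (ZMod p)ˣ).range := by
    rintro ⟨u, v⟩
    have hsum : ∀ x : Fin s → (ZMod p)ˣ, ∑ l, f (u, v) l * (x l : ZMod p) ^ k =
        v * ((x j : ZMod p) ^ k - u * (x i : ZMod p) ^ k) := by
      intro x
      rw [Finset.sum_eq_add i j hij (fun l _ hl => by rw [hfl _ _ hl.1 hl.2, zero_mul])
        (fun h => absurd (Finset.mem_univ _) h) (fun h => absurd (Finset.mem_univ _) h), hfi, hfj]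
      ring
    constructor
    · rintro ⟨-, x, hx⟩
      rw [hsum, mul_eq_zero] at hx
      have := sub_eq_zero.1 (hx.resolve_left v.ne_zero)
      refine ⟨x j * (x i)⁻¹, Units.ext ?_⟩
      have hxi : (x i : ZMod p) ^ k ≠ 0 := pow_ne_zero _ (x i).ne_zero
      simp only [powMonoidHom_apply, Units.val_pow_eq_pow_val, Units.val_mul, mul_pow, this]
      rw [Units.val_inv_eq_inv_val, inv_pow, mul_assoc, mul_inv_cancel₀ hxi, mul_one]
    · rintro ⟨y, hy⟩
      refine ⟨⟨j, by rw [hfj]; exact v.ne_zero⟩, fun l => if l = j then y else 1, ?_⟩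
      rw [hsum]
      have hy' := congrArg (Units.val) hy
      simp only [powMonoidHom_apply, Units.val_pow_eq_pow_val] at hy'
      simp [hij, hy']
  have himg : {r : Fin s → ZMod p | (∀ l, r l ≠ 0 ↔ l = i ∨ l = j) ∧ r ∉ residueSoluble k s p} =
      f '' (((powMonoidHom k : (ZMod p)ˣ →* (ZMod p)ˣ).range : Set (ZMod p)ˣ)ᶜ ×ˢ Set.univ) := by
    ext r
    constructor
    · rintro ⟨hr, hns⟩
      have hi := (hr i).2 (Or.inl rfl)
      have hj := (hr j).2 (Or.inr rfl)
      let v := Units.mk0 (r j) hj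
      let u := Units.mk0 (-(r i / r j)) (neg_ne_zero.2 (div_ne_zero hi hj))
      have hfr : f (u, v) = r := by
        funext l
        by_cases h1 : l = i
        · subst h1; rw [hfi]; simp [u, v, hj]
        by_cases h2 : l = j
        · subst h2; rw [hfj]; simp [v]
        rw [hfl _ _ h1 h2]
        by_contra h
        rcases (hr l).1 (Ne.symm h) with h | h <;> contradiction
      refine ⟨(u, v), ⟨fun hu => hns ?_, trivial⟩, hfr⟩
      rw [← hfr, hsolv]
      exact hu
    · rintro ⟨⟨u, v⟩, ⟨hu, -⟩, rfl⟩
      refine ⟨fun l => ?_, fun h => hu ((hsolv _).1 h)⟩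
      by_cases h1 : l = i
      · subst h1; rw [hfi]; simp
      by_cases h2 : l = j
      · subst h2; rw [hfj]; simp
      simp [hfl _ _ h1 h2, h1, h2]
  rw [himg, Set.ncard_image_of_injective _ hinj, Set.ncard_prod, Nat.cast_mul, card_units_not_pow,
    Set.ncard_univ, Nat.card_eq_fintype_card, ZMod.card_units, Nat.cast_sub hp.out.one_lt.le]
  push_cast
  ring

theorem not_residueSoluble_single {k s p : ℕ} [hp : Fact p.Prime] {i : Fin s} {r : Fin s → ZMod p}
    (hr : ∀ l, r l ≠ 0 ↔ l = i) : r ∉ residueSoluble k s p := by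
  rintro ⟨-, x, hx⟩
  rw [Finset.sum_eq_single i (fun l _ hl => by
    rw [not_ne_iff.1 (mt (hr l).1 hl), zero_mul]) (fun h => absurd (Finset.mem_univ _) h)] at hx
  exact mul_ne_zero ((hr i).2 rfl) (pow_ne_zero _ (x i).ne_zero) hx

theorem card_single {s p : ℕ} [hp : Fact p.Prime] (i : Fin s) :
    {r : Fin s → ZMod p | ∀ l, r l ≠ 0 ↔ l = i}.ncard = p - 1 := by
  classical
  have himg : {r : Fin s → ZMod p | ∀ l, r l ≠ 0 ↔ l = i} =
      Set.range fun u : (ZMod p)ˣ => Pi.single (M := fun _ : Fin s => ZMod p) i (u : ZMod p) := by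
    ext r
    constructor
    · intro hr
      have hr' : ∀ l, r l ≠ 0 ↔ l = i := hr
      refine ⟨Units.mk0 (r i) ((hr' i).2 rfl), funext fun l => ?_⟩
      by_cases h : l = i
      · subst h; simp
      · simp only [Pi.single_eq_of_ne h]
        exact (not_ne_iff.1 (mt (hr' l).1 h)).symm
    · rintro ⟨u, rfl⟩ l
      by_cases h : l = i
      · subst h; simp
      · simp [h]
  rw [himg, ← Set.image_univ, Set.ncard_image_of_injective, Set.ncard_univ,
    Nat.card_eq_fintype_card, ZMod.card_units]
  exact (Pi.single_injective i).comp Units.val_injective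

/-- The insoluble tuples are sorted by support. Supports of size three or more contribute nothing, a
single nonzero entry is never soluble, and the zero tuple is excluded from `residueSoluble` by
definition, hence the summand 1. -/
theorem card_insoluble_residues {k s p : ℕ} [hp : Fact p.Prime] (hk : 0 < k) (hs : 2 ≤ s)
    (hpk : 16 * k ^ 6 < p) :
    ((residueSoluble k s p)ᶜ.ncard : ℝ) = 1 + s * ((p : ℝ) - 1) +
      s.choose 2 * (((p : ℝ) - 1) ^ 2 * (1 - ((Nat.gcd (p - 1) k : ℕ) : ℝ)⁻¹)) := by
  classical
  let supp : (Fin s → ZMod p) → Finset (Fin s) := fun r => Finset.univ.filter fun l => r l ≠ 0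
  set B : Finset (Fin s → ZMod p) := Finset.univ.filter fun r => r ∉ residueSoluble k s p with hB
  have hBc : (residueSoluble k s p)ᶜ.ncard = B.card := by
    rw [← Set.ncard_coe_finset]; congr 1; ext r; simp [hB]
  let F : ℕ → ℝ := fun m => if m = 0 then 1 else if m = 1 then (p : ℝ) - 1 else
    if m = 2 then ((p : ℝ) - 1) ^ 2 * (1 - ((Nat.gcd (p - 1) k : ℕ) : ℝ)⁻¹) else 0
  have hfib : ∀ S : Finset (Fin s), ((B.filter fun r => supp r = S).card : ℝ) = F S.card := by
    intro S
    have hset : ((B.filter fun r => supp r = S : Finset _) : Set (Fin s → ZMod p)) =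
        {r | (∀ l, r l ≠ 0 ↔ l ∈ S) ∧ r ∉ residueSoluble k s p} := by
      ext r
      simp only [hB, supp, Finset.coe_filter, Finset.mem_filter, Finset.mem_univ, true_and,
        Set.mem_ofPred_eq, Finset.ext_iff]
      exact and_comm
    rw [← Set.ncard_coe_finset, hset]
    rcases lt_or_ge 2 S.card with h3 | h3
    · have : {r : Fin s → ZMod p | (∀ l, r l ≠ 0 ↔ l ∈ S) ∧ r ∉ residueSoluble k s p} = ∅ := by
        rw [Set.eq_empty_iff_forall_notMem]
        rintro r ⟨hr, hn⟩
        have hc : (Finset.univ.filter fun l => r l ≠ 0) = S := by ext l; simp [hr]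
        obtain ⟨l, hl⟩ := Finset.card_pos.1 (by omega : 0 < S.card)
        exact hn ⟨⟨l, (hr l).2 hl⟩, exists_unit_zero_of_three hk hpk r (by rw [hc]; omega)⟩
      rw [this]
      simp [F, show S.card ≠ 0 by omega, show S.card ≠ 1 by omega, show S.card ≠ 2 by omega]
    · interval_cases hS : S.card
      · rw [Finset.card_eq_zero] at hS
        subst hS
        have : {r : Fin s → ZMod p | (∀ l, r l ≠ 0 ↔ l ∈ (∅ : Finset (Fin s))) ∧
            r ∉ residueSoluble k s p} = {0} := by
          ext r
          simp only [Finset.notMem_empty, iff_false, not_not, Set.mem_ofPred_eq,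
            Set.mem_singleton_iff, residueSoluble, funext_iff, Pi.zero_apply]
          exact ⟨fun h => h.1, fun h => ⟨h, fun ⟨⟨j, hj⟩, _⟩ => hj (h j)⟩⟩
        rw [this]
        simp [F]
      · obtain ⟨i, rfl⟩ := Finset.card_eq_one.1 hS
        have : {r : Fin s → ZMod p | (∀ l, r l ≠ 0 ↔ l ∈ ({i} : Finset (Fin s))) ∧
            r ∉ residueSoluble k s p} = {r | ∀ l, r l ≠ 0 ↔ l = i} := by
          ext r
          simp only [Finset.mem_singleton, Set.mem_ofPred_eq]
          exact ⟨fun h => h.1, fun h => ⟨h, not_residueSoluble_single h⟩⟩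
        rw [this, card_single, Nat.cast_sub hp.out.one_lt.le]
        simp [F]
      · obtain ⟨i, j, hij, rfl⟩ := Finset.card_eq_two.1 hS
        simp only [Finset.mem_insert, Finset.mem_singleton]
        rw [card_pair_insoluble hij]
        simp [F]
  rw [hBc, Finset.card_eq_sum_card_fiberwise (f := supp)
    (t := (Finset.univ : Finset (Fin s)).powerset) (fun r _ => by simp)]
  push_cast
  rw [Finset.sum_congr rfl fun S _ => hfib S, Finset.sum_powerset_apply_card, Finset.card_univ,
    Fintype.card_fin, ← Finset.sum_subset (Finset.range_subset_range.2 (by omega : 3 ≤ s + 1))]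
  · simp [Finset.sum_range_succ, F]
  · intro m _ hm
    have : 3 ≤ m := by simpa using hm
    simp [F, show m ≠ 0 by omega, show m ≠ 1 by omega, show m ≠ 2 by omega]

theorem delta_eq {k s : ℕ} (hk : 0 < k) (hs : 2 ≤ s) (p : Nat.Primes)
    (hpk : 16 * k ^ 6 < (p : ℕ)) :
    delta k s p =
        1 - (1 - 1 / ((p : ℕ) : ℝ) ^ s)⁻¹ *
          ((s : ℝ) * (1 - 1 / ((p : ℕ) : ℝ)) * (1 / ((p : ℕ) : ℝ) ^ (s - 1)) +
            (s : ℝ) * ((s : ℝ) - 1) / 2 * (1 - 1 / ((p : ℕ) : ℝ)) ^ 2 *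
              (1 - ((Nat.gcd ((p : ℕ) - 1) k : ℕ) : ℝ)⁻¹) *
              (1 / ((p : ℕ) : ℝ) ^ (s - 2))) := by
  have hkp : ¬ (p : ℕ) ∣ k := fun hd => by
    have h1 := Nat.le_of_dvd hk hd
    have h2 : k ≤ k ^ 6 := Nat.le_self_pow (by norm_num) k
    omega
  have h1 := delta_mul_eq hk.ne' (by omega) p p.2.pos (isPeriodic_levelSet_one (s := s) hkp)
  have hc := Set.ncard_add_ncard_compl (residueSoluble k s p)
  rw [Nat.card_eq_fintype_card, Fintype.card_fun, ZMod.card, Fintype.card_fin] at hc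
  have hc' := congrArg (Nat.cast : ℕ → ℝ) hc
  rw [Nat.cast_add, Nat.cast_pow, card_insoluble_residues hk hs hpk,
    ← eq_sub_iff_add_eq] at hc'
  rw [periodDensity, residues_levelSet_one hkp, hc', Nat.cast_choose_two] at h1
  have hpos := one_sub_pow_pos (s := s) p.2.two_le (by omega)
  rw [← eq_div_iff hpos.ne'] at h1
  rw [h1]
  have hp0 : ((p : ℕ) : ℝ) ≠ 0 := by exact_mod_cast p.2.ne_zero
  obtain ⟨m, rfl⟩ : ∃ m, s = m + 2 := ⟨s - 2, by omega⟩
  rw [show m + 2 - 1 = m + 1 by omega, show m + 2 - 2 = m by omega]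
  have e : ∀ X G S : ℝ, X ≠ 0 → 1 - 1 / X ^ (m + 2) ≠ 0 →
      (X ^ (m + 2) - (1 + S * (X - 1) + S * (S - 1) / 2 * ((X - 1) ^ 2 * G))) / X ^ (m + 2) /
        (1 - 1 / X ^ (m + 2)) =
      1 - (1 - 1 / X ^ (m + 2))⁻¹ * (S * (1 - 1 / X) * (1 / X ^ (m + 1)) +
        S * (S - 1) / 2 * (1 - 1 / X) ^ 2 * G * (1 / X ^ m)) := by
    intro X G S hX hne
    rw [div_eq_iff hne, sub_mul, mul_right_comm, inv_mul_cancel₀ hne]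
    field_simp
    ring
  exact e _ _ _ hp0 hpos.ne'

/-! ### The product of the local densities -/

theorem summable_one_sub_delta {k s : ℕ} (hk : 0 < k) (hs : 4 ≤ s) :
    Summable fun p : Nat.Primes => delta k s p - 1 := by
  have h1 : Summable fun p : Nat.Primes => (s.choose 2 : ℝ) * (1 / ((p : ℕ) : ℝ) ^ 2) :=
    ((Real.summable_one_div_nat_pow.2 one_lt_two).comp_injective Nat.Primes.coe_nat_injective).mul_left _
  refine Summable.of_norm_bounded_eventually h1 ?_
  have hfin : {p : Nat.Primes | (p : ℕ) ≤ 16 * k ^ 6}.Finite :=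
    (Set.finite_Iic (16 * k ^ 6)).preimage Nat.Primes.coe_nat_injective.injOn
  filter_upwards [hfin.compl_mem_cofinite] with p hp
  have hp' : 16 * k ^ 6 < (p : ℕ) := not_le.1 hp
  have h2 := one_sub_delta_le hk (by omega : 2 ≤ s) p hp'
  have hp1 : (1 : ℝ) ≤ ((p : ℕ) : ℝ) := by exact_mod_cast p.2.one_lt.le
  rw [Real.norm_eq_abs, abs_sub_comm, abs_of_nonneg (sub_nonneg.2 (delta_le_one hk.ne' (by omega) p))]
  refine h2.trans ?_
  rw [div_eq_mul_one_div]
  gcongr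
  omega

theorem multipliable_delta {k s : ℕ} (hk : 0 < k) (hs : 4 ≤ s) :
    Multipliable fun p : Nat.Primes => delta k s p := by
  have := Real.multipliable_one_add_of_summable (summable_one_sub_delta hk hs)
  simpa using this

/-- The factors are positive with summable logarithms, so the product is an exponential. -/
theorem tprod_delta_pos {k s : ℕ} (hk : 0 < k) (hs : 4 ≤ s) :
    0 < ∏' p : Nat.Primes, delta k s p := by
  have h := Real.summable_log_one_add_of_summable (summable_one_sub_delta hk hs)
  simp only [add_sub_cancel] at h
  rw [← Real.rexp_tsum_eq_tprod (fun p => delta_pos hk.ne' (by omega) p) h]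
  exact Real.exp_pos _

/-- The primes up to `P`. -/
def primesUpTo (P : ℕ) : Finset Nat.Primes := (Nat.primesLE P).subtype Nat.Prime

theorem mem_primesUpTo {P : ℕ} {p : Nat.Primes} : p ∈ primesUpTo P ↔ (p : ℕ) ≤ P := by
  refine (Finset.mem_subtype (p := Nat.Prime) (s := Nat.primesLE P) (a := p)).trans ?_
  rw [Nat.mem_primesLE]
  exact ⟨fun h => h.1, fun h => ⟨h, p.2⟩⟩

theorem card_primesUpTo_le (P : ℕ) : (primesUpTo P).card ≤ P := by
  calc (primesUpTo P).card ≤ (Finset.Icc 1 P).card :=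
        Finset.card_le_card_of_injOn (fun p => (p : ℕ))
          (fun p hp => by
            simpa using ⟨p.2.one_lt.le, mem_primesUpTo.1 hp⟩)
          Nat.Primes.coe_nat_injective.injOn
    _ = P := by simp

/-- Since `s ≥ 4`, a factor `P ^ (-(s - 4))` can be taken out, leaving the tail of the sum of
inverse squares over integers, at most `2 / P`. -/
theorem sum_primes_gt_le {s P : ℕ} (hs : 4 ≤ s) (hP : 0 < P) (F : Finset Nat.Primes)
    (hF : ∀ p ∈ F, P < (p : ℕ)) :
    ∑ p ∈ F, 1 / ((p : ℕ) : ℝ) ^ (s - 2) ≤ 2 / (P : ℝ) ^ (s - 3) := by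
  have hP0 : (0 : ℝ) < P := by exact_mod_cast hP
  obtain ⟨m, rfl⟩ : ∃ m, s = m + 4 := ⟨s - 4, by omega⟩
  rw [show m + 4 - 2 = m + 2 by omega, show m + 4 - 3 = m + 1 by omega]
  have h1 : ∑ p ∈ F, 1 / ((p : ℕ) : ℝ) ^ (m + 2) ≤
      ∑ p ∈ F, 1 / (P : ℝ) ^ m * (((p : ℕ) : ℝ) ^ 2)⁻¹ := by
    refine Finset.sum_le_sum fun p hp => ?_
    have hpP : (P : ℝ) ≤ ((p : ℕ) : ℝ) := by exact_mod_cast (hF p hp).le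
    have hp0 : (0 : ℝ) < ((p : ℕ) : ℝ) := hP0.trans_le hpP
    rw [pow_add, one_div, mul_inv, ← one_div]
    gcongr
  have h2 : ∑ p ∈ F, (((p : ℕ) : ℝ) ^ 2)⁻¹ ≤ 2 / (P : ℝ) := by
    let N := F.sup (fun p : Nat.Primes => (p : ℕ)) + 1
    have h3 : ∑ p ∈ F, (((p : ℕ) : ℝ) ^ 2)⁻¹ =
        ∑ n ∈ F.map ⟨fun p : Nat.Primes => (p : ℕ), Nat.Primes.coe_nat_injective⟩, ((n : ℝ) ^ 2)⁻¹ := by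
      rw [Finset.sum_map]; rfl
    have h4 : F.map ⟨fun p : Nat.Primes => (p : ℕ), Nat.Primes.coe_nat_injective⟩ ⊆ Finset.Ioo P N := by
      intro n hn
      obtain ⟨p, hp, rfl⟩ := Finset.mem_map.1 hn
      exact Finset.mem_Ioo.2 ⟨hF p hp, Nat.lt_succ_of_le (Finset.le_sup (f := fun p : Nat.Primes => (p : ℕ)) hp)⟩
    rw [h3]
    refine (Finset.sum_le_sum_of_subset_of_nonneg h4 fun _ _ _ => by positivity).trans
      ((sum_Ioo_inv_sq_le P N).trans ?_)
    gcongr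
    linarith
  rw [← Finset.mul_sum] at h1
  refine h1.trans ((mul_le_mul_of_nonneg_left h2 (by positivity)).trans (le_of_eq ?_))
  rw [pow_succ]; field_simp

theorem abs_prod_sub_prod_le {ι : Type*} (I : Finset ι) (x y : ι → ℝ)
    (hx : ∀ i ∈ I, 0 ≤ x i ∧ x i ≤ 1) (hy : ∀ i ∈ I, 0 ≤ y i ∧ y i ≤ 1) :
    |∏ i ∈ I, x i - ∏ i ∈ I, y i| ≤ ∑ i ∈ I, |x i - y i| := by
  classical
  induction I using Finset.induction_on with
  | empty => simp
  | insert i I hi ih =>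
    have ih' := ih (fun j hj => hx j (Finset.mem_insert_of_mem hj))
      (fun j hj => hy j (Finset.mem_insert_of_mem hj))
    obtain ⟨hx0, hx1⟩ := hx i (Finset.mem_insert_self _ _)
    have hY0 : 0 ≤ ∏ j ∈ I, y j :=
      Finset.prod_nonneg fun j hj => (hy j (Finset.mem_insert_of_mem hj)).1
    have hY1 : ∏ j ∈ I, y j ≤ 1 := Finset.prod_le_one
      (fun j hj => (hy j (Finset.mem_insert_of_mem hj)).1)
      (fun j hj => (hy j (Finset.mem_insert_of_mem hj)).2)
    rw [Finset.prod_insert hi, Finset.prod_insert hi, Finset.sum_insert hi]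
    have e : x i * ∏ j ∈ I, x j - y i * ∏ j ∈ I, y j =
        (x i - y i) * ∏ j ∈ I, y j + x i * (∏ j ∈ I, x j - ∏ j ∈ I, y j) := by ring
    rw [e]
    refine (abs_add_le _ _).trans (add_le_add ?_ ?_)
    · rw [abs_mul, abs_of_nonneg hY0]
      exact mul_le_of_le_one_right (abs_nonneg _) hY1
    · rw [abs_mul, abs_of_nonneg hx0]
      exact (mul_le_of_le_one_left (abs_nonneg _) hx1).trans ih'

theorem abs_prod_delta_sub_tprod_le {k s P : ℕ} (hk : 0 < k) (hs : 4 ≤ s) (hP : 16 * k ^ 6 ≤ P) :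
    |∏ p ∈ primesUpTo P, delta k s p - ∏' p : Nat.Primes, delta k s p| ≤
      s.choose 2 * (2 / (P : ℝ) ^ (s - 3)) := by
  classical
  have hP0 : 0 < P := lt_of_lt_of_le (by positivity) hP
  have hδ : ∀ p : Nat.Primes, 0 ≤ delta k s p ∧ delta k s p ≤ 1 := fun p =>
    ⟨(delta_pos hk.ne' (by omega) p).le, delta_le_one hk.ne' (by omega) p⟩
  have hlim : Tendsto (fun F : Finset Nat.Primes => ∏ p ∈ F, delta k s p) atTop
      (𝓝 (∏' p : Nat.Primes, delta k s p)) := (multipliable_delta hk hs).hasProd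
  refine le_of_tendsto (hlim.const_sub _).abs ?_
  filter_upwards [eventually_ge_atTop (primesUpTo P)] with F hF
  -- Padding the partial product with factors 1 puts both products on the same index set, so only
  -- primes above `P` contribute to the difference.
  have e1 : ∏ p ∈ primesUpTo P, delta k s p =
      ∏ p ∈ F, if p ∈ primesUpTo P then delta k s p else 1 := by
    rw [Finset.prod_ite_mem, Finset.inter_eq_right.2 hF]
  rw [e1]
  refine (abs_prod_sub_prod_le F _ _ (fun p _ => ?_) fun p _ => hδ p).trans ?_
  · split_ifs
    · exact hδ p
    · exact ⟨zero_le_one, le_rfl⟩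
  have hFP : ∀ p ∈ F \ primesUpTo P, P < (p : ℕ) := fun p hp =>
    not_le.1 fun h => (Finset.mem_sdiff.1 hp).2 (mem_primesUpTo.2 h)
  rw [← Finset.sum_sdiff hF, Finset.sum_eq_zero (s := primesUpTo P) (fun p hp => by simp [hp]),
    add_zero]
  refine le_trans (Finset.sum_le_sum (g := fun p : Nat.Primes => (s.choose 2 : ℝ) *
    (1 / ((p : ℕ) : ℝ) ^ (s - 2))) fun p hp => ?_) ?_
  · rw [if_neg (Finset.mem_sdiff.1 hp).2, abs_of_nonneg (sub_nonneg.2 (hδ p).2), mul_one_div]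
    exact one_sub_delta_le hk (by omega) p (hP.trans_lt (hFP p hp))
  · rw [← Finset.mul_sum]
    exact mul_le_mul_of_nonneg_left (sum_primes_gt_le hs hP0 _ hFP) (by positivity)

/-! ### Counting the everywhere soluble equations -/

/-- The tuples soluble at all primes up to `P` and not divisible by high powers of such primes. -/
def sieveSet (k s P : ℕ) : Set (Fin s → ℤ) :=
  ⋂ p ∈ primesUpTo P, levelSet k s p (2 * Nat.log (p : ℕ) P)

/-- The modulus of `sieveSet`. -/
def sieveModulus (k P : ℕ) : ℕ := P.lcmUpto ^ (2 * k + 4)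

theorem one_le_log_of_mem {P : ℕ} {p : Nat.Primes} (hp : p ∈ primesUpTo P) :
    1 ≤ Nat.log (p : ℕ) P :=
  Nat.log_pos p.2.one_lt (mem_primesUpTo.1 hp)

/-- An exponent `Nat.log p P + 1` would do; doubling the logarithm instead keeps it a multiple of
`Nat.log p P`, so that the total modulus is a power of `P.lcmUpto`. -/
theorem le_pow_two_log {P : ℕ} {p : Nat.Primes} (hp : p ∈ primesUpTo P) :
    P ≤ (p : ℕ) ^ (2 * Nat.log (p : ℕ) P) :=
  (Nat.lt_pow_succ_log_self p.2.one_lt P).le.trans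
    (Nat.pow_le_pow_right p.2.pos (by have := one_le_log_of_mem hp; omega))

/-- With `L = Nat.log p P ≥ 1` and level `2L`, the Hensel exponent `4L + 2k` is at most `(2k + 4)
L`. -/
theorem isPeriodic_sieve_level {k : ℕ} (hk : 0 < k) (s : ℕ) {P : ℕ} {p : Nat.Primes}
    (hp : p ∈ primesUpTo P) :
    IsPeriodic ((p : ℕ) ^ ((2 * k + 4) * Nat.log (p : ℕ) P))
      (levelSet k s p (2 * Nat.log (p : ℕ) P)) := by
  refine (isPeriodic_levelSet hk.ne' s p _).of_dvd (pow_dvd_pow _ ?_)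
  have := one_le_log_of_mem hp
  nlinarith

theorem sieveModulus_eq_prod (k P : ℕ) :
    sieveModulus k P = ∏ p ∈ primesUpTo P, (p : ℕ) ^ ((2 * k + 4) * Nat.log (p : ℕ) P) := by
  rw [sieveModulus, Nat.lcmUpto_eq_prod_pow_log, ← Finset.prod_pow]
  refine Eq.trans ?_ (Finset.prod_subtype_of_mem (fun q : ℕ => q ^ ((2 * k + 4) * Nat.log q P))
    (fun q hq => (Nat.mem_primesLE.1 hq).2)).symm
  exact Finset.prod_congr rfl fun q _ => by rw [← pow_mul, mul_comm]

theorem sieveModulus_pos (k P : ℕ) : 0 < sieveModulus k P := pow_pos (Nat.lcmUpto_pos P) _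

theorem sieveSet_periodic {k : ℕ} (hk : 0 < k) (s P : ℕ) :
    IsPeriodic (sieveModulus k P) (sieveSet k s P) ∧
      periodDensity (sieveModulus k P) (sieveSet k s P) = ∏ p ∈ primesUpTo P,
        periodDensity ((p : ℕ) ^ ((2 * k + 4) * Nat.log (p : ℕ) P))
          (levelSet k s p (2 * Nat.log (p : ℕ) P)) := by
  rw [sieveModulus_eq_prod]
  refine periodDensity_biInter (primesUpTo P)
    (fun p => (p : ℕ) ^ ((2 * k + 4) * Nat.log (p : ℕ) P))
    (fun p => levelSet k s p (2 * Nat.log (p : ℕ) P))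
    (fun p hp => isPeriodic_sieve_level hk s hp) ?_
  intro p _ q _ hpq
  exact Nat.Coprime.pow _ _ ((Nat.coprime_primes p.2 q.2).2 fun h =>
    hpq (Nat.Primes.coe_nat_injective h))

theorem natCast_mul_pow_le {P s : ℕ} (hP : 0 < P) (hs : 4 ≤ s) {x : ℝ} (hx : 0 ≤ x) :
    (P : ℝ) * (x / P) ^ s ≤ x ^ s / (P : ℝ) ^ (s - 3) := by
  have hP1 : (1 : ℝ) ≤ P := by exact_mod_cast hP
  have hP0 : (0 : ℝ) < P := by linarith
  obtain ⟨m, rfl⟩ : ∃ m, s = m + 4 := ⟨s - 4, by omega⟩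
  rw [show m + 4 - 3 = m + 1 by omega, div_pow, mul_div_assoc', div_le_div_iff₀ (by positivity)
    (by positivity)]
  have : (P : ℝ) * P ^ (m + 1) ≤ P ^ (m + 4) := by
    rw [← pow_succ']
    exact pow_le_pow_right₀ hP1 (by omega)
  calc (P : ℝ) * x ^ (m + 4) * P ^ (m + 1) = x ^ (m + 4) * (P * P ^ (m + 1)) := by ring
    _ ≤ _ := by gcongr

theorem abs_density_sieveSet_sub_le {k s P : ℕ} (hk : 0 < k) (hs : 4 ≤ s) (hP : 16 * k ^ 6 ≤ P) :
    |periodDensity (sieveModulus k P) (sieveSet k s P) - ∏' p : Nat.Primes, delta k s p| ≤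
      (2 * s.choose 2 + 1) / (P : ℝ) ^ (s - 3) := by
  have hP0 : 0 < P := lt_of_lt_of_le (by positivity) hP
  have h1 := abs_prod_delta_sub_tprod_le hk hs hP
  have hPR : (0 : ℝ) < P := by exact_mod_cast hP0
  have h2 : |periodDensity (sieveModulus k P) (sieveSet k s P) -
      ∏ p ∈ primesUpTo P, delta k s p| ≤ 1 / (P : ℝ) ^ (s - 3) := by
    rw [(sieveSet_periodic hk s P).2]
    refine (abs_prod_sub_prod_le _ _ _ (fun p _ => ⟨periodDensity_nonneg _ _,
      periodDensity_le_one (pow_pos p.2.pos _) _⟩)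
      (fun p _ => ⟨(delta_pos hk.ne' (by omega) p).le, delta_le_one hk.ne' (by omega) p⟩)).trans ?_
    have h3 : ∀ p ∈ primesUpTo P,
        |periodDensity ((p : ℕ) ^ ((2 * k + 4) * Nat.log (p : ℕ) P))
          (levelSet k s p (2 * Nat.log (p : ℕ) P)) - delta k s p| ≤ (1 / (P : ℝ)) ^ s := by
      intro p hp
      rw [abs_sub_comm]
      refine (abs_delta_sub_le hk.ne' (by omega) p (pow_pos p.2.pos _)
        (isPeriodic_sieve_level hk s hp)).trans ?_
      have : (P : ℝ) ≤ ((p : ℕ) : ℝ) ^ (2 * Nat.log (p : ℕ) P) := by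
        exact_mod_cast le_pow_two_log hp
      gcongr
    refine (Finset.sum_le_sum h3).trans ?_
    rw [Finset.sum_const, nsmul_eq_mul]
    have h4 : ((primesUpTo P).card : ℝ) ≤ P := by exact_mod_cast card_primesUpTo_le P
    refine (mul_le_mul_of_nonneg_right h4 (by positivity)).trans ?_
    simpa using natCast_mul_pow_le hP0 hs zero_le_one
  refine (abs_sub_le _ (∏ p ∈ primesUpTo P, delta k s p) _).trans ((add_le_add h2 h1).trans
    (le_of_eq ?_))
  ring

theorem boxCount_le_of_inter_subset {s : ℕ} {S T : Set (Fin s → ℤ)} {A : ℝ}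
    (h : S ∩ box s A ⊆ T) : boxCount S A ≤ boxCount T A := by
  rw [boxCount_eq, boxCount_eq]
  exact Set.ncard_le_ncard (Set.subset_inter h Set.inter_subset_right) (finite_inter_box _ _)

/-- As `s ≥ 3`, some nonzero coefficient is divisible by `p`. Hence only finitely many primes can
obstruct solubility in a given box. -/
theorem le_of_insoluble {k s : ℕ} (hk : 0 < k) (hs : 3 ≤ s) (p : Nat.Primes)
    (hpk : 16 * k ^ 6 < (p : ℕ)) {a : Fin s → ℤ} (ha : ∀ j, a j ≠ 0)
    (hna : a ∉ padicSoluble k s p) {A : ℝ} (hA : a ∈ box s A) : ((p : ℕ) : ℝ) ≤ A := by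
  have h := insoluble_subset hk (by omega) p hpk ⟨mem_signed_univ.2 ha, hna⟩
  simp only [Set.mem_iUnion] at h
  obtain ⟨t, ht, hat⟩ := h
  have htc := (Finset.mem_powersetCard.1 ht).2
  obtain ⟨j, -, hj⟩ : ∃ j ∈ (Finset.univ : Finset (Fin s)), j ∉ t :=
    Finset.exists_mem_notMem_of_card_lt_card (by rw [htc, Finset.card_univ, Fintype.card_fin]; omega)
  have hd := (hat j).2
  rw [if_neg hj] at hd
  have h1 := Int.le_of_dvd (abs_pos.2 (ha j)) ((dvd_abs _ _).2 hd)
  have h2 : ((p : ℕ) : ℝ) ≤ |(a j : ℝ)| := by exact_mod_cast h1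
  exact h2.trans (hA j)

/-- An everywhere soluble tuple outside the sieve set has all coefficients divisible by a prime
power at least `P`. There are at most `P` such primes, each costing at most `(2A / P) ^ s`. -/
theorem boxCount_everywhereSoluble_le {k s P : ℕ} (hk : 0 < k) (hs : 4 ≤ s) (hP : 0 < P) {A : ℝ}
    (hA : 0 ≤ A) :
    (boxCount (everywhereSoluble k s) A : ℝ) ≤
      boxCount (sieveSet k s P ∩ signed (mixedSigns s)) A + (2 * A) ^ s / (P : ℝ) ^ (s - 3) := by
  have hPR : (0 : ℝ) < P := by exact_mod_cast hP
  have hsub : everywhereSoluble k s ⊆ (sieveSet k s P ∩ signed (mixedSigns s)) ∪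
      ⋃ p ∈ primesUpTo P,
        {a | ∀ j, a j ≠ 0 ∧ (((p : ℕ) ^ (2 * Nat.log (p : ℕ) P) : ℕ) : ℤ) ∣ a j} := by
    rintro a ⟨hr, hp⟩
    rw [realSoluble_eq_signed hk.ne' (by omega)] at hr
    by_cases h : a ∈ sieveSet k s P
    · exact Or.inl ⟨h, hr⟩
    · right
      simp only [sieveSet, Set.mem_iInter, not_forall] at h
      obtain ⟨p, hpP, hnp⟩ := h
      refine Set.mem_biUnion hpP ?_
      rcases padicSoluble_subset p (2 * Nat.log (p : ℕ) P) (hp p) with h | h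
      · exact absurd h.1 hnp
      · exact h
  have h1 : (boxCount (everywhereSoluble k s) A : ℝ) ≤
      boxCount (sieveSet k s P ∩ signed (mixedSigns s)) A + ∑ p ∈ primesUpTo P,
        (boxCount {a : Fin s → ℤ | ∀ j, a j ≠ 0 ∧
          (((p : ℕ) ^ (2 * Nat.log (p : ℕ) P) : ℕ) : ℤ) ∣ a j} A : ℝ) := by
    exact_mod_cast (boxCount_mono hsub A).trans ((boxCount_union_le _ _ _).trans
      (Nat.add_le_add_left (boxCount_biUnion_le _ _ _) _))
  refine h1.trans (add_le_add_right ?_ _)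
  refine (Finset.sum_le_sum (g := fun _ => (2 * A / P) ^ s) fun p hp => ?_).trans ?_
  · refine (boxCount_all_multiples_le s (pow_pos p.2.pos _) hA).trans ?_
    have : (P : ℝ) ≤ (((p : ℕ) ^ (2 * Nat.log (p : ℕ) P) : ℕ) : ℝ) := by
      exact_mod_cast le_pow_two_log hp
    gcongr
  · rw [Finset.sum_const, nsmul_eq_mul]
    have h4 : ((primesUpTo P).card : ℝ) ≤ P := by exact_mod_cast card_primesUpTo_le P
    exact (mul_le_mul_of_nonneg_right h4 (by positivity)).trans
      (natCast_mul_pow_le hP hs (by positivity))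

/-- A sieved tuple that is not everywhere soluble fails at a prime between `P` and `A`; the
insoluble counts at those primes are summed. -/
theorem le_boxCount_everywhereSoluble {k s P : ℕ} (hk : 0 < k) (hs : 4 ≤ s) (hP : 16 * k ^ 6 ≤ P)
    {A : ℝ} (hA : 0 ≤ A) :
    (boxCount (sieveSet k s P ∩ signed (mixedSigns s)) A : ℝ) ≤
      boxCount (everywhereSoluble k s) A + 2 * s.choose 2 * (2 * A) ^ s / (P : ℝ) ^ (s - 3) := by
  classical
  have hP0 : 0 < P := lt_of_lt_of_le (by positivity) hP
  set F := primesUpTo ⌊A⌋₊ \ primesUpTo P with hF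
  have hFP : ∀ p ∈ F, P < (p : ℕ) := fun p hp =>
    not_le.1 fun h => (Finset.mem_sdiff.1 hp).2 (mem_primesUpTo.2 h)
  have hsub : (sieveSet k s P ∩ signed (mixedSigns s)) ∩ box s A ⊆ everywhereSoluble k s ∪
      ⋃ p ∈ F, (signed Finset.univ \ padicSoluble k s p) := by
    rintro a ⟨⟨hsv, hsg⟩, hbox⟩
    by_cases h : ∀ p : Nat.Primes, a ∈ padicSoluble k s p
    · left
      refine ⟨?_, h⟩
      rw [realSoluble_eq_signed hk.ne' (by omega)]
      exact hsg
    · right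
      push Not at h
      obtain ⟨p, hp⟩ := h
      have hpP : p ∉ primesUpTo P := fun hpP => hp <| by
        have := Set.mem_iInter₂.1 hsv p hpP
        exact ⟨hsg.1, this.2⟩
      have hpP' : P < (p : ℕ) := not_le.1 fun h => hpP (mem_primesUpTo.2 h)
      have hpA := le_of_insoluble hk (by omega) p (hP.trans_lt hpP') hsg.1 hp hbox
      exact Set.mem_biUnion (Finset.mem_sdiff.2 ⟨mem_primesUpTo.2 (Nat.le_floor hpA), hpP⟩)
        ⟨mem_signed_univ.2 hsg.1, hp⟩
  have h1 : (boxCount (sieveSet k s P ∩ signed (mixedSigns s)) A : ℝ) ≤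
      boxCount (everywhereSoluble k s) A +
        ∑ p ∈ F, (boxCount (signed Finset.univ \ padicSoluble k s p) A : ℝ) := by
    exact_mod_cast (boxCount_le_of_inter_subset hsub).trans ((boxCount_union_le _ _ _).trans
      (Nat.add_le_add_left (boxCount_biUnion_le _ _ _) _))
  refine h1.trans (add_le_add_right ?_ _)
  refine (Finset.sum_le_sum (g := fun p : Nat.Primes => s.choose 2 * (2 * A) ^ s *
    (1 / ((p : ℕ) : ℝ) ^ (s - 2))) fun p hp => ?_).trans ?_
  · refine (boxCount_insoluble_le hk (by omega) p (hP.trans_lt (hFP p hp)) hA).trans (le_of_eq ?_)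
    ring
  · rw [← Finset.mul_sum]
    refine (mul_le_mul_of_nonneg_left (sum_primes_gt_le hs hP0 _ hFP) (by positivity)).trans
      (le_of_eq ?_)
    ring

theorem abs_boxCount_everywhereSoluble_sub_le {k s P : ℕ} (hk : 0 < k) (hs : 4 ≤ s)
    (hP : 16 * k ^ 6 ≤ P) {A : ℝ} (hA : (sieveModulus k P : ℝ) ≤ A) :
    |(boxCount (everywhereSoluble k s) A : ℝ) - totalDensity s k * (2 * A) ^ s| ≤
      (2 * A) ^ s * (3 ^ s * (sieveModulus k P / A) +
        2 * (2 * s.choose 2 + 1) / (P : ℝ) ^ (s - 3)) := by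
  have hP0 : 0 < P := lt_of_lt_of_le (by positivity) hP
  have hPR : (0 : ℝ) < P := by exact_mod_cast hP0
  have hQ0 := sieveModulus_pos k P
  have hQR : (0 : ℝ) < sieveModulus k P := by exact_mod_cast hQ0
  have hA0 : 0 < A := hQR.trans_le hA
  set d := periodDensity (sieveModulus k P) (sieveSet k s P) with hd
  have hd1 : d ≤ 1 := periodDensity_le_one hQ0 _
  have hd0 : 0 ≤ d := periodDensity_nonneg _ _
  set D := ∏' p : Nat.Primes, delta k s p with hD
  have hi0 : 0 < deltaInfty s := deltaInfty_pos (by omega)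
  have hi1 : deltaInfty s ≤ 1 := deltaInfty_le_one s
  have h1 := abs_boxCount_sub_le hQ0 (sieveSet_periodic hk s P).1 (mixedSigns s) hA
  rw [card_mixedSigns (by omega), ← hd] at h1
  have h2 := boxCount_everywhereSoluble_le hk hs hP0 hA0.le
  have h3 := le_boxCount_everywhereSoluble hk hs hP hA0.le
  have h4 := abs_density_sieveSet_sub_le hk hs hP
  rw [← hd, ← hD] at h4
  set R := (P : ℝ) ^ (s - 3) with hR
  have hR0 : 0 < R := by positivity
  set q := (sieveModulus k P : ℝ) / A with hq
  have hq0 : 0 < q := by positivity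
  have hX0 : 0 < (2 * A) ^ s := by positivity
  have eX : (2 * A) ^ s = 2 ^ s * A ^ s := mul_pow _ _ _
  set X := (2 * A) ^ s with hX
  set c : ℝ := ((s.choose 2 : ℕ) : ℝ) with hc
  have hc0 : 0 ≤ c := by positivity
  have h1' : |(boxCount (sieveSet k s P ∩ signed (mixedSigns s)) A : ℝ) - deltaInfty s * d * X| ≤
      X * (3 ^ s * q) := by
    have e : deltaInfty s * 2 ^ s * d * A ^ s = deltaInfty s * d * X := by rw [eX]; ring
    rw [e] at h1
    refine h1.trans ?_
    have e2 : deltaInfty s * 2 ^ s * d * 3 ^ s * A ^ s * q =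
        (deltaInfty s * d) * (X * (3 ^ s * q)) := by rw [eX]; ring
    rw [e2]
    exact mul_le_of_le_one_left (by positivity) (mul_le_one₀ hi1 hd0 hd1)
  have h4' : |deltaInfty s * d * X - deltaInfty s * D * X| ≤ X * ((2 * c + 1) / R) := by
    have e : deltaInfty s * d * X - deltaInfty s * D * X = deltaInfty s * (X * (d - D)) := by ring
    rw [e, abs_mul, abs_of_pos hi0, abs_mul, abs_of_pos hX0]
    exact (mul_le_of_le_one_left (by positivity) hi1).trans (by gcongr)
  have h5 : |(boxCount (everywhereSoluble k s) A : ℝ) -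
      boxCount (sieveSet k s P ∩ signed (mixedSigns s)) A| ≤ X * ((2 * c + 1) / R) := by
    have e : X * ((2 * c + 1) / R) = 2 * c * X / R + X / R := by ring
    have p1 : 0 ≤ 2 * c * X / R := by positivity
    have p2 : 0 ≤ X / R := by positivity
    rw [e, abs_le]
    constructor <;> linarith
  have e : totalDensity s k * X = deltaInfty s * D * X := rfl
  have e3 : X * (3 ^ s * q + 2 * (2 * c + 1) / R) =
      X * ((2 * c + 1) / R) + (X * (3 ^ s * q) + X * ((2 * c + 1) / R)) := by ring
  rw [e, e3]
  exact (abs_sub_le _ _ _).trans (add_le_add h5 ((abs_sub_le _ _ _).trans (add_le_add h1' h4')))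

/-- Chebyshev's bound, since the logarithm of `lcm(1, …, P)` is `ψ(P)`. -/
theorem sieveModulus_le_exp (k P : ℕ) :
    (sieveModulus k P : ℝ) ≤ Real.exp ((2 * k + 4) * ((Real.log 4 + 4) * P)) := by
  have h1 := Chebyshev.psi_le_const_mul_self (Nat.cast_nonneg (α := ℝ) P)
  rw [Chebyshev.psi_eq_log_lcmUpto] at h1
  have h2 : (0 : ℝ) < P.lcmUpto := by exact_mod_cast Nat.lcmUpto_pos P
  have h3 := (Real.log_le_iff_le_exp h2).1 h1
  rw [sieveModulus]
  push_cast
  calc (P.lcmUpto : ℝ) ^ (2 * k + 4) ≤ Real.exp ((Real.log 4 + 4) * P) ^ (2 * k + 4) := by gcongr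
    _ = _ := by
      rw [← Real.exp_nat_mul]
      push_cast
      rfl

theorem isBigO_boxCount_everywhereSoluble {k s : ℕ} (hk : 0 < k) (hs : 4 ≤ s) :
    (fun A : ℝ => (boxCount (everywhereSoluble k s) A : ℝ) - totalDensity s k * (2 * A) ^ s)
      =O[atTop] fun A : ℝ => A ^ s / Real.log A ^ (s - 3) := by
  have hl4 : 0 < Real.log 4 := Real.log_pos (by norm_num)
  -- Chosen so that the exponential bound for the modulus at `P ≤ c * log A` is at most `A ^ (1/2)`.
  set c : ℝ := 1 / (2 * ((2 * k + 4) * (Real.log 4 + 4))) with hc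
  have hc0 : 0 < c := by positivity
  set K : ℝ := 2 ^ s * (3 ^ s + 2 * (2 * s.choose 2 + 1) * (2 / c) ^ (s - 3)) with hK
  refine IsBigO.of_bound K ?_
  -- The bound 2 ensures that the floor `P` is still at least `c / 2 * log A`; the other bound makes
  -- every prime above `P` large enough for the three-coefficient criterion.
  have hlog : ∀ᶠ A : ℝ in atTop, max 2 (16 * (k : ℝ) ^ 6 + 1) ≤ c * Real.log A :=
    (Real.tendsto_log_atTop.const_mul_atTop hc0).eventually_ge_atTop _
  have hsmall : ∀ᶠ A : ℝ in atTop, Real.log A ^ (s - 3) ≤ A ^ (1 / 2 : ℝ) := by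
    have h1 : (fun A : ℝ => Real.log A ^ (s - 3)) =o[atTop] fun A : ℝ => A ^ (1 / 2 : ℝ) := by
      have := isLittleO_log_rpow_rpow_atTop ((s - 3 : ℕ) : ℝ) (by norm_num : (0 : ℝ) < 1 / 2)
      simpa only [Real.rpow_natCast] using this
    filter_upwards [h1.bound one_pos, eventually_gt_atTop 0] with A hA hA0
    rw [one_mul, Real.norm_eq_abs, Real.norm_eq_abs, abs_of_nonneg (by positivity : 0 ≤ A ^ (1 / 2 : ℝ))] at hA
    exact (le_abs_self _).trans hA
  filter_upwards [hlog, hsmall, eventually_gt_atTop 1] with A hA1 hA2 hA3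
  have hA0 : 0 < A := by linarith
  have hlA : 0 < Real.log A := Real.log_pos hA3
  set P := ⌊c * Real.log A⌋₊ with hP
  have hPle : (P : ℝ) ≤ c * Real.log A := Nat.floor_le (by positivity)
  have hPge : c * Real.log A - 1 < P := by
    have := Nat.lt_floor_add_one (c * Real.log A); linarith
  have h2 : 2 ≤ c * Real.log A := (le_max_left _ _).trans hA1
  have h16 : 16 * (k : ℝ) ^ 6 + 1 ≤ c * Real.log A := (le_max_right _ _).trans hA1
  have hPk : 16 * k ^ 6 ≤ P := by
    apply Nat.le_floor; push_cast; linarith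
  have hQ : (sieveModulus k P : ℝ) ≤ A ^ (1 / 2 : ℝ) := by
    refine (sieveModulus_le_exp k P).trans ?_
    rw [Real.rpow_def_of_pos hA0]
    apply Real.exp_le_exp.2
    calc (2 * (k : ℝ) + 4) * ((Real.log 4 + 4) * P)
        ≤ (2 * (k : ℝ) + 4) * ((Real.log 4 + 4) * (c * Real.log A)) := by gcongr
      _ = Real.log A * (1 / 2) := by rw [hc]; field_simp
  have hhalf : A ^ (1 / 2 : ℝ) * A ^ (1 / 2 : ℝ) = A := by
    rw [← Real.rpow_add hA0]; norm_num
  have hsq : 0 < A ^ (1 / 2 : ℝ) := Real.rpow_pos_of_pos hA0 _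
  have hAge : A ^ (1 / 2 : ℝ) ≤ A := by
    calc A ^ (1 / 2 : ℝ) ≤ A ^ (1 : ℝ) := Real.rpow_le_rpow_of_exponent_le hA3.le (by norm_num)
      _ = A := Real.rpow_one A
  have hmain := abs_boxCount_everywhereSoluble_sub_le hk hs hPk (hQ.trans hAge)
  have hPc : c / 2 * Real.log A ≤ P := by linarith
  have hq : (sieveModulus k P : ℝ) / A ≤ 1 / Real.log A ^ (s - 3) := by
    rw [div_le_div_iff₀ hA0 (by positivity), one_mul]
    calc _ ≤ A ^ (1 / 2 : ℝ) * A ^ (1 / 2 : ℝ) := by gcongr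
      _ = A := hhalf
  have hr : 1 / (P : ℝ) ^ (s - 3) ≤ (2 / c) ^ (s - 3) * (1 / Real.log A ^ (s - 3)) := by
    calc 1 / (P : ℝ) ^ (s - 3) ≤ 1 / (c / 2 * Real.log A) ^ (s - 3) := by gcongr
      _ = _ := by rw [mul_pow, one_div, mul_inv, ← inv_pow, inv_div, one_div]
  rw [Real.norm_eq_abs, Real.norm_eq_abs,
    abs_of_nonneg (by positivity : 0 ≤ A ^ s / Real.log A ^ (s - 3))]
  refine hmain.trans ?_
  calc (2 * A) ^ s * (3 ^ s * (sieveModulus k P / A) +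
        2 * (2 * s.choose 2 + 1) / (P : ℝ) ^ (s - 3))
      = (2 * A) ^ s * (3 ^ s * (sieveModulus k P / A) +
        2 * (2 * s.choose 2 + 1) * (1 / (P : ℝ) ^ (s - 3))) := by ring
    _ ≤ (2 * A) ^ s * (3 ^ s * (1 / Real.log A ^ (s - 3)) +
        2 * (2 * s.choose 2 + 1) * ((2 / c) ^ (s - 3) * (1 / Real.log A ^ (s - 3)))) := by gcongr
    _ = K * (A ^ s / Real.log A ^ (s - 3)) := by rw [hK, mul_pow]; ring

end DiagonalDensity

end

theorem mainTheorem3 (k s : ℕ) (hk : 2 ≤ k) (hs : 4 ≤ s) :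
    (DiagonalDensity.HasDensity (DiagonalDensity.realSoluble k s) (DiagonalDensity.deltaInfty s) ∧
      0 < DiagonalDensity.deltaInfty s) ∧
    (∀ p : Nat.Primes,
      DiagonalDensity.HasDensity (DiagonalDensity.padicSoluble k s p)
        (DiagonalDensity.delta k s p) ∧
      0 < DiagonalDensity.delta k s p) ∧
    (Multipliable (fun p : Nat.Primes => DiagonalDensity.delta k s p) ∧
      0 < DiagonalDensity.totalDensity s k) ∧
    ((fun A : ℝ =>
        (DiagonalDensity.boxCount (DiagonalDensity.everywhereSoluble k s) A : ℝ) -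
          DiagonalDensity.totalDensity s k * (2 * A) ^ s)
      =O[atTop] fun A : ℝ => A ^ s / Real.log A ^ (s - 3)) ∧
    (∃ p₀ : ℕ, ∀ p : Nat.Primes, p₀ ≤ (p : ℕ) →
      DiagonalDensity.delta k s p =
        1 - (1 - 1 / ((p : ℕ) : ℝ) ^ s)⁻¹ *
          ((s : ℝ) * (1 - 1 / ((p : ℕ) : ℝ)) * (1 / ((p : ℕ) : ℝ) ^ (s - 1)) +
            (s : ℝ) * ((s : ℝ) - 1) / 2 * (1 - 1 / ((p : ℕ) : ℝ)) ^ 2 *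
              (1 - ((Nat.gcd ((p : ℕ) - 1) k : ℕ) : ℝ)⁻¹) *
              (1 / ((p : ℕ) : ℝ) ^ (s - 2)))) := by
  have hk0 : 0 < k := by omega
  have hs0 : 0 < s := by omega
  have hs2 : 2 ≤ s := by omega
  exact ⟨⟨DiagonalDensity.hasDensity_realSoluble hk0.ne' hs0, DiagonalDensity.deltaInfty_pos hs2⟩,
    fun p => ⟨DiagonalDensity.hasDensity_padicSoluble hk0.ne' hs0 p,
      DiagonalDensity.delta_pos hk0.ne' hs2 p⟩,
    ⟨DiagonalDensity.multipliable_delta hk0 hs,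
      mul_pos (DiagonalDensity.deltaInfty_pos hs2) (DiagonalDensity.tprod_delta_pos hk0 hs)⟩,
    DiagonalDensity.isBigO_boxCount_everywhereSoluble hk0 hs,
    16 * k ^ 6 + 1, fun p hp => DiagonalDensity.delta_eq hk0 hs2 p (by omega)⟩
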